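/- **Conventions.** For a set $A$, $A^*$ is the set of words on $A$, $\lambda$ is the empty word, $|w|$ is the length of $w=(w_0,\dots,w_{|w|-1})$, and a mapping $\varphi:A\to B^*$ extends to $\varphi^\sharp:A^*\to B^*$, $\varphi^\sharp(w)=\varphi(w_0)\cdots\varphi(w_{|w|-1})$ (concatenation). A many-sorted signature $(T,\Lambda)$ is a set $T$ of sorts with a set $\Lambda_{w,s}$ of formal operations $\sigma:w\to s$ for all $w\in T^*$, $s\in T$. For a $T$-sorted set $X$, $\mathrm T_\Lambda(X)$ is the $T$-sorted set of terms on $X$. For $w\in T^*$, $\downarrow w$ is the $T$-sorted set of variables $v_0,\dots,v_{|w|-1}$, with $v_i$ of sort $w_i$, and $\mathrm{BTer}(\Lambda)_{u,w}=\prod_{i\in|w|}\mathrm T_\Lambda(\downarrow u)_{w_i}$ is the set of families of terms of type $u\to w$; for $P:u\to v$ and $Q:v\to w$, $Q\circ P:u\to w$ is obtained by substitution. An equation of type $(X,Y)$, for $T$-sorted sets $X,Y$, is a pair of sorted mappings from $Y$ to $\mathrm T_\Lambda(X)$; an equation between two terms of sort $s$ on $\downarrow w$ is one of type $(\downarrow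 w,\downarrow(s))$. A specification is a signature with a family $\mathcal H$ of equations, and $\mathrm{Cn}(\mathcal H)$ is the family of the equations (of all types) that are valid in all algebras that satisfy $\mathcal H$. **The 2-category $\mathbf{Spf}_{\mathfrak{pd}}$.** A polyderivor $\mathbf d=(\varphi,d)$ from $(S,\Sigma)$ to $(T,\Lambda)$ consists of a mapping $\varphi:S\to T^*$ and, for every $\sigma:w\to s$ in $\Sigma$, a family of terms $d(\sigma)\in\mathrm{BTer}(\Lambda)_{\varphi^\sharp(w),\varphi(s)}$. It translates the terms: a term $P$ of sort $s$ on $X$ goes to a family of terms $d^\sharp(P)$ of type $\varphi(s)$ on the sorted set that has, for every variable $x$ of sort $r$ in $X$ and every $j\in|\varphi(r)|$, a variable $x_j$ of sort $\varphi(r)_j$; the variable $x$ goes to $(x_0,\dots,x_{|\varphi(r)|-1})$ and $\sigma(P_0,\dots,P_{n-1})$ goes to $d(\sigma)$ with $d^\sharp(P_0),\dots,d^\sharp(P_{n-1})$ substituted. Families of terms $u\to w$ are so translated to families of terms $\varphi^\sharp(u)\to\varphi^\sharp(w)$. The identity polyderivor sends $s$ to $(s)$ and $\sigma:w\to s$ to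 $(\sigma(v_0,\dots,v_{|w|-1}))$, and $(\psi,e)\circ(\varphi,d)=(\psi^\sharp\circ\varphi,e^\sharp\circ d)$. The objects of $\mathbf{Spf}_{\mathfrak{pd}}$ are the specifications. The 1-cells from $(S,\Sigma,\mathcal E)$ to $(T,\Lambda,\mathcal H)$ are the polyderivors that respect the equations, that is, that translate the equations of $\mathcal E$ to elements of $\mathrm{Cn}(\mathcal H)$. A transformation from $(\varphi,d)$ to $(\psi,e)$ is a choice of $\xi_s\in\mathrm{BTer}(\Lambda)_{\varphi(s),\psi(s)}$, for $s\in S$, such that, for every $\sigma:w\to s$, $\xi_s\circ d(\sigma)$ and $e(\sigma)\circ\xi_w$ are equal modulo $\mathrm{Cn}(\mathcal H)$, where $\xi_w:\varphi^\sharp(w)\to\psi^\sharp(w)$ is the juxtaposition of $\xi_{w_0},\dots,\xi_{w_{|w|-1}}$. The 2-cells are the transformations, two of them being identified if their components are equal modulo $\mathrm{Cn}(\mathcal H)$; vertical composition is componentwise, and the horizontal composite of $\xi:(\varphi,d)\Rightarrow(\psi,e)$ with $\chi:(\varphi',h)\Rightarrow(\psi',k)$ has the components $\chi_{\psi(s)}\circ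 h^\sharp(\xi_s)$. **The specification $\mathrm H_S$ of Hall.** Let $S$ be a set. The sorts are the elements of $S^*\times S$; the formal operations are $\pi_i^w:\lambda\to(w,w_i)$, for $w\in S^*$, $i\in|w|$, and $\xi_{u,w,s}:((w,s),(u,w_0),\dots,(u,w_{|w|-1}))\to(u,s)$, for $u,w\in S^*$, $s\in S$. The equations are, for all $u,v,w\in S^*$, $s\in S$, $i\in|w|$: - (H1) $\xi_{u,w,w_i}(\pi_i^w,y_0,\dots,y_{|w|-1})=y_i$, with variables $y_j$ of sort $(u,w_j)$; - (H2) $\xi_{u,u,s}(x,\pi_0^u,\dots,\pi_{|u|-1}^u)=x$, with a variable $x$ of sort $(u,s)$; - (H3) $\xi_{u,v,s}(\xi_{v,w,s}(x,y_0,\dots,y_{|w|-1}),z_0,\dots,z_{|v|-1})=\xi_{u,w,s}(x,\xi_{u,v,w_0}(y_0,z_0,\dots,z_{|v|-1}),\dots,\xi_{u,v,w_{|w|-1}}(y_{|w|-1},z_0,\dots,z_{|v|-1}))$, with variables $x$ of sort $(w,s)$, $y_j$ of sort $(v,w_j)$ and $z_j$ of sort $(u,v_j)$. **The specification $\mathrm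 B_S$ of Bénabou.** The sorts are the elements of $S^*\times S^*$; the formal operations are $\pi_i^w:\lambda\to(w,(w_i))$, $\langle\rangle_{u,w}:((u,(w_0)),\dots,(u,(w_{|w|-1})))\to(u,w)$ and $\circ_{u,x,w}:((u,x),(x,w))\to(u,w)$, for $u,x,w\in S^*$, $i\in|w|$; write $Q\circ P$ for $\circ_{u,x,w}(P,Q)$. The equations are, for all $u,x,w,y\in S^*$, $i\in|w|$: - (B1) $\pi_i^w\circ\langle y_0,\dots,y_{|w|-1}\rangle_{u,w}=y_i$, with variables $y_j$ of sort $(u,(w_j))$; - (B2) $p\circ\langle\pi_0^u,\dots,\pi_{|u|-1}^u\rangle_{u,u}=p$, with a variable $p$ of sort $(u,w)$; - (B3) $\langle\pi_0^w\circ p,\dots,\pi_{|w|-1}^w\circ p\rangle_{u,w}=p$, with a variable $p$ of sort $(u,w)$; - (B4) $\langle\pi_0^w\rangle_{w,(w_0)}=\pi_0^w$, if $w\neq\lambda$; - (B5) $p\circ(q\circ r)=(p\circ q)\circ r$, with variables $p,q,r$ of sorts $(w,y)$, $(x,w)$, $(u,x)$. **Proposition.** For every set $S$, the specifications $\mathrm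 B_S$ and $\mathrm H_S$ are equivalent in the 2-category $\mathbf{Spf}_{\mathfrak{pd}}$. More precisely: 1. The polyderivor $\mathbf d=(\varphi,d)$ from $\mathrm B_S$ to $\mathrm H_S$ given by $\varphi(u,w)=((u,w_0),\dots,(u,w_{|w|-1}))$, $d(\pi_i^w)=(\pi_i^w)$, $d(\langle\rangle_{u,w})=(v_0,\dots,v_{|w|-1})$ and $$d(\circ_{u,x,w})=\bigl(\xi_{u,x,w_i}(v_{|x|+i},v_0,\dots,v_{|x|-1})\bigr)_{i\in|w|}$$ respects the equations. 2. The polyderivor $\mathbf e=(\psi,e)$ from $\mathrm H_S$ to $\mathrm B_S$ given by $\psi(w,s)=((w,(s)))$, $e(\pi_i^w)=(\pi_i^w)$ and $e(\xi_{u,w,s})=(v_0\circ\langle v_1,\dots,v_{|w|}\rangle_{u,w})$ respects the equations. 3. The families $\chi_{(u,w)}=(\pi_0^w\circ v_0,\dots,\pi_{|w|-1}^w\circ v_0)$ and $\rho_{(u,w)}=(\langle v_0,\dots,v_{|w|-1}\rangle_{u,w})$, for $(u,w)\in S^*\times S^*$, are transformations $\chi:\mathrm{id}\Rightarrow\mathbf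 e\circ\mathbf d$ and $\rho:\mathbf e\circ\mathbf d\Rightarrow\mathrm{id}$ and give mutually inverse 2-cells. 4. The family of the one-term families $(v_0)$, of type $((w,s))\to((w,s))$ for $(w,s)\in S^*\times S$, is a transformation $\mathbf d\circ\mathbf e\Rightarrow\mathrm{id}$ as well as a transformation $\mathrm{id}\Rightarrow\mathbf d\circ\mathbf e$, and the two give mutually inverse 2-cells. -/

import Mathlib

open CategoryTheory

universe u

namespace ManySorted

/-! ### Words, variables and tuples -/

/-- `Var w s` is the set `(↓w)_s` of the variables of sort `s` attached to the word `w`, that is, of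
the positions `i` of `w` such that `w_i = s`. Thus `Var w` is the sorted set `↓w`. -/
inductive Var {S : Type u} : List S → S → Type u
  | zero {s : S} {w : List S} : Var (s :: w) s
  | succ {a s : S} {w : List S} : Var w s → Var (a :: w) s

/-- The set `A_w = ∏ i, A_{w_i}`, as the set of the sorted mappings from `↓w` to `A`. -/
abbrev Tuple {S : Type u} (A : S → Type u) (w : List S) : Type u :=
  ∀ s, Var w s → A s

namespace Var

variable {R S : Type u}

/-- The `i`-th position of `w`, as a position of the image of the word `w` under `f`. -/
def map (f : R → S) : ∀ {w : List R} {r : R}, Var w r → Var (w.map f) (f r)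
  | _, _, zero => zero
  | _, _, succ k => succ (map f k)

/-- A position of `v`, as a position of the concatenation `v ++ w`. -/
def left : ∀ {v : List S} (w : List S) {s : S}, Var v s → Var (v ++ w) s
  | _, _, _, zero => zero
  | _, w, _, succ k => succ (left w k)

/-- A position of `w`, as a position of the concatenation `v ++ w`. -/
def right : ∀ (v : List S) {w : List S} {s : S}, Var w s → Var (v ++ w) s
  | [], _, _, k => k
  | _ :: v, _, _, k => succ (right v k)

/-- A position of a concatenation is a position of exactly one of the two words. -/
def split : ∀ (v : List S) {w : List S} {s : S}, Var (v ++ w) s → Var v s ⊕ Var w s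
  | [], _, _, k => Sum.inr k
  | _ :: _, _, _, zero => Sum.inl zero
  | _ :: v, _, _, succ k => (split v k).map succ id

/-- The position, in the concatenation of the words `φ(w_0), …, φ(w_{n-1})`, of the `j`-th letter of
`φ(w_i)`. -/
def flat {φ : R → List S} : ∀ {w : List R} {r : R} {s : S},
    Var w r → Var (φ r) s → Var (w.flatMap φ) s
  | _ :: w, _, _, zero, j => left (w.flatMap φ) j
  | a :: _, _, _, succ i, j => right (φ a) (flat i j)

/-- The inverse of `flat`: a position of the concatenation of the words `φ(w_0), …, φ(w_{n-1})` is
determined by a position `i` of `w` and a position of `φ(w_i)`. -/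
def unflat {φ : R → List S} : ∀ {w : List R} {s : S},
    Var (w.flatMap φ) s → Σ r : R, Var w r × Var (φ r) s
  | [], _, k => nomatch k
  | a :: w, _, k =>
    match split (φ a) (w := w.flatMap φ) k with
    | Sum.inl j => ⟨a, zero, j⟩
    | Sum.inr k => ⟨(unflat k).1, succ (unflat k).2.1, (unflat k).2.2⟩

theorem split_left : ∀ (v w : List S) {s : S} (k : Var v s), split v (left w k) = Sum.inl k
  | _ :: _, _, _, zero => rfl
  | _ :: v, w, _, succ k => by simp [left, split, split_left v w k]

theorem split_right : ∀ (v : List S) {w : List S} {s : S} (k : Var w s),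
    split v (right v k) = Sum.inr k
  | [], _, _, _ => rfl
  | _ :: v, _, _, k => by simp [right, split, split_right v k]

theorem split_cases (v : List S) {w : List S} {s : S} (k : Var (v ++ w) s) :
    (∃ i, k = left w i) ∨ ∃ j, k = right v j := by
  induction v with
  | nil => exact Or.inr ⟨k, rfl⟩
  | cons a v ih =>
    cases k with
    | zero => exact Or.inl ⟨zero, rfl⟩
    | succ k =>
      rcases ih k with ⟨i, rfl⟩ | ⟨j, rfl⟩
      · exact Or.inl ⟨succ i, rfl⟩
      · exact Or.inr ⟨j, rfl⟩

@[simp]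
theorem unflat_flat {φ : R → List S} {w : List R} {r : R} {s : S} (i : Var w r)
    (j : Var (φ r) s) : unflat (flat i j) = ⟨r, i, j⟩ := by
  induction i with
  | zero => simp only [flat, unflat, split_left]
  | @succ a r' w' i ih =>
    have h : ∀ p : Σ r, Var w' r × Var (φ r) s, p = ⟨r', i, j⟩ →
        (⟨p.1, succ p.2.1, p.2.2⟩ : Σ r, Var (a :: w') r × Var (φ r) s) = ⟨r', succ i, j⟩ := by
      rintro _ rfl
      rfl
    simpa only [flat, unflat, split_right] using h _ (ih j)

theorem exists_flat {φ : R → List S} {w : List R} {s : S} (k : Var (w.flatMap φ) s) :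
    ∃ (r : R) (i : Var w r) (j : Var (φ r) s), k = flat i j := by
  induction w with
  | nil => exact nomatch k
  | cons a w ih =>
    rcases split_cases (φ a) (w := w.flatMap φ) k with ⟨i, rfl⟩ | ⟨j, rfl⟩
    · exact ⟨a, zero, i, rfl⟩
    · obtain ⟨r, i, j, rfl⟩ := ih j
      exact ⟨r, succ i, j, rfl⟩

/-- The identification of the words `ψ♯(φ♯(w))` and `(ψ♯ ∘ φ)♯(w)`, position by position. -/
def assoc {T : Type u} {φ : R → List S} {ψ : S → List T} {w : List R} {t : T}
    (k : Var ((w.flatMap φ).flatMap ψ) t) : Var (w.flatMap fun r => (φ r).flatMap ψ) t :=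
  flat (φ := fun r => (φ r).flatMap ψ) (unflat (unflat k).2.1).2.1
    (flat (unflat (unflat k).2.1).2.2 (unflat k).2.2)

@[simp]
theorem assoc_flat {T : Type u} {φ : R → List S} {ψ : S → List T} {w : List R} {r : R} {s : S}
    {t : T} (i : Var w r) (j : Var (φ r) s) (k : Var (ψ s) t) :
    assoc (flat (flat i j) k) = flat (φ := fun r => (φ r).flatMap ψ) i (flat j k) := by
  have h₁ : ∀ p : Σ r, Var w r × Var (φ r) s, p = ⟨r, i, j⟩ →
      flat (φ := fun r => (φ r).flatMap ψ) p.2.1 (flat p.2.2 k) =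
        flat (φ := fun r => (φ r).flatMap ψ) i (flat j k) := by
    rintro _ rfl
    rfl
  have h₂ : ∀ p : Σ s, Var (w.flatMap φ) s × Var (ψ s) t, p = ⟨s, flat i j, k⟩ →
      flat (φ := fun r => (φ r).flatMap ψ) (unflat p.2.1).2.1 (flat (unflat p.2.1).2.2 p.2.2) =
        flat (φ := fun r => (φ r).flatMap ψ) i (flat j k) := by
    rintro _ rfl
    exact h₁ _ (unflat_flat i j)
  exact h₂ _ (unflat_flat (flat i j) k)

end Var

namespace Tuple

variable {R S : Type u} {A : S → Type u}

/-- The empty tuple. -/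
def nil : Tuple A [] := fun _ k => nomatch k

/-- The tuple `(a, b_0, …, b_{n-1})`. -/
def cons {s : S} {w : List S} (a : A s) (b : Tuple A w) : Tuple A (s :: w)
  | _, Var.zero => a
  | _, Var.succ k => b _ k

/-- The tuple `(a)` of length one. -/
def single {s : S} (a : A s) : Tuple A [s] := cons a nil

/-- A family `(a_i)` with `a_i ∈ A_{f(w_i)}`, as a tuple of type `(f(w_0), …, f(w_{n-1}))`. -/
def ofMap {f : R → S} : ∀ {w : List R}, (∀ r, Var w r → A (f r)) → Tuple A (w.map f)
  | [], _ => nil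
  | _ :: _, a => cons (a _ Var.zero) (ofMap fun r k => a r k.succ)

/-- A tuple of tuples `a_i ∈ A_{φ(w_i)}`, as a tuple of type `φ(w_0) ⋯ φ(w_{n-1})`. -/
def ofFlat {φ : R → List S} {w : List R} (a : Tuple (fun r => Tuple A (φ r)) w) :
    Tuple A (w.flatMap φ) :=
  fun t k => a _ k.unflat.2.1 t k.unflat.2.2

@[simp]
theorem ofFlat_flat {φ : R → List S} {w : List R} (a : Tuple (fun r => Tuple A (φ r)) w)
    {r : R} {s : S} (i : Var w r) (j : Var (φ r) s) : ofFlat a s (i.flat j) = a r i s j := by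
  have h : ∀ p : Σ r, Var w r × Var (φ r) s, p = ⟨r, i, j⟩ → a _ p.2.1 s p.2.2 = a r i s j := by
    rintro _ rfl
    rfl
  exact h _ (Var.unflat_flat i j)

end Tuple

/-! ### Signatures, algebras and terms -/

/-- A many-sorted signature `(S, Σ)`. -/
structure Signature : Type (u + 1) where
  /-- The set of sorts. -/
  Sorts : Type u
  /-- The formal operations `σ : w → s` of arity `w` and coarity `s`. -/
  Op : List Sorts → Sorts → Type u

/-- A many-sorted algebra for a signature. -/
structure Algebra (Sg : Signature.{u}) : Type (u + 1) where
  carrier : Sg.Sorts → Type u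
  op : ∀ {w : List Sg.Sorts} {s : Sg.Sorts}, Sg.Op w s → Tuple carrier w → carrier s

/-- `Term Sg X s` is the set of the terms of type `(X, s)`. -/
inductive Term (Sg : Signature.{u}) (X : Sg.Sorts → Type u) : Sg.Sorts → Type u
  | var {s : Sg.Sorts} : X s → Term Sg X s
  | op {w : List Sg.Sorts} {s : Sg.Sorts} : Sg.Op w s → (∀ t, Var w t → Term Sg X t) → Term Sg X s

/-- The free algebra on a sorted set. -/
abbrev Term.algebra (Sg : Signature.{u}) (X : Sg.Sorts → Type u) : Algebra Sg where
  carrier := Term Sg X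
  op := Term.op

/-- The canonical extension `f♯`, to the terms, of a valuation `f` of the variables. -/
def Algebra.lift {Sg : Signature.{u}} (A : Algebra Sg) {X : Sg.Sorts → Type u}
    (f : ∀ s, X s → A.carrier s) : ∀ {s : Sg.Sorts}, Term Sg X s → A.carrier s
  | _, Term.var x => f _ x
  | _, Term.op σ a => A.op σ fun t k => A.lift f (a t k)

/-- `Term.subst f P` is the term obtained from `P` by substituting `f x` for every variable `x`. -/
def Term.subst {Sg : Signature.{u}} {X Y : Sg.Sorts → Type u} (f : ∀ s, X s → Term Sg Y s)
    {s : Sg.Sorts} (P : Term Sg X s) : Term Sg Y s :=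
  (Term.algebra Sg Y).lift f P

/-- The morphisms from `X` to `Y` in the category of terms, i.e., in the dual of the Kleisli
category of the free algebra monad: the sorted mappings from `Y` to the terms on `X`. -/
abbrev Terms (Sg : Signature.{u}) (X Y : Sg.Sorts → Type u) : Type u :=
  ∀ s, Y s → Term Sg X s

/-- The identity of `X` in the category of terms. -/
def Terms.id (Sg : Signature.{u}) (X : Sg.Sorts → Type u) : Terms Sg X X :=
  fun _ x => Term.var x

/-- The composition `Q ∘ P` of `P : X → Y` and `Q : Y → Z` in the category of terms. -/
def Terms.comp {Sg : Signature.{u}} {X Y Z : Sg.Sorts → Type u} (Q : Terms Sg Y Z)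
    (P : Terms Sg X Y) : Terms Sg X Z :=
  fun s z => (Q s z).subst P

/-- The set `BTer(Σ)_{u,w}` of the families of terms of type `u → w`. -/
abbrev BTer (Sg : Signature.{u}) (u w : List Sg.Sorts) : Type u :=
  Terms Sg (Var u) (Var w)

/-! ### Equations, consequence and specifications -/

/-- The algebra `A` satisfies the equation `(P, Q)` of type `(X, Y)`. -/
def Algebra.Satisfies {Sg : Signature.{u}} (A : Algebra Sg) {X Y : Sg.Sorts → Type u}
    (P Q : Terms Sg X Y) : Prop :=
  ∀ (f : ∀ s, X s → A.carrier s) (s : Sg.Sorts) (y : Y s), A.lift f (P s y) = A.lift f (Q s y)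

/-- A family of equations of arbitrary types `(X, Y)`. -/
abbrev Equations (Sg : Signature.{u}) : Type (u + 1) :=
  ∀ X Y : Sg.Sorts → Type u, Terms Sg X Y → Terms Sg X Y → Prop

/-- The algebra `A` is a model of a family of equations. -/
def Algebra.Models {Sg : Signature.{u}} (A : Algebra Sg) (E : Equations Sg) : Prop :=
  ∀ X Y P Q, E X Y P Q → A.Satisfies P Q

/-- The family `Cn(E)` of the semantical consequences of a family of equations `E`. -/
def Equations.Cn {Sg : Signature.{u}} (E : Equations Sg) : Equations Sg :=
  fun _ _ P Q => ∀ A : Algebra Sg, A.Models E → A.Satisfies P Q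

/-- A many-sorted specification: a signature with a family of equations. -/
structure Spec : Type (u + 1) where
  sig : Signature.{u}
  eqs : Equations sig

/-! ### Polyderivors -/

/-- A polyderivor sends the sorts of the first signature to words on the sorts of the second one, and
an operation `σ : w → s` to a family of terms of type `φ♯(w) → φ(s)`. -/
structure Polyderivor (Sg Lg : Signature.{u}) : Type u where
  sort : Sg.Sorts → List Lg.Sorts
  op : ∀ {w : List Sg.Sorts} {s : Sg.Sorts}, Sg.Op w s → BTer Lg (w.flatMap sort) (sort s)

namespace Polyderivor

variable {Sg Lg Og : Signature.{u}}

/-- The algebra for the first signature derived from an algebra `B` for the second one. -/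
abbrev pull (d : Polyderivor Sg Lg) (B : Algebra Lg) : Algebra Sg where
  carrier s := Tuple B.carrier (d.sort s)
  op σ a := fun t j => B.lift (Tuple.ofFlat a) (d.op σ t j)

/-- The sorted set `∐†_φ X`: it has, for every variable `x` of sort `s` in `X` and every position `j`
of the word `φ(s)`, a variable `(x, j)` of sort `φ(s)_j`. -/
abbrev expand (d : Polyderivor Sg Lg) (X : Sg.Sorts → Type u) : Lg.Sorts → Type u :=
  fun t => Σ s : Sg.Sorts, X s × Var (d.sort s) t

/-- The translation of the terms: the homomorphism from the free algebra on `X` to the algebra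
derived from the free algebra on `Y` that sends the variable `x` to the tuple of variables `g x`. -/
def translate (d : Polyderivor Sg Lg) {X : Sg.Sorts → Type u} {Y : Lg.Sorts → Type u}
    (g : ∀ s, X s → Tuple Y (d.sort s)) {s : Sg.Sorts} (P : Term Sg X s) :
    Tuple (Term Lg Y) (d.sort s) :=
  (d.pull (Term.algebra Lg Y)).lift (fun s x t j => Term.var (g s x t j)) P

/-- The translation functor between the categories of terms. -/
def diamond (d : Polyderivor Sg Lg) {X Y : Sg.Sorts → Type u} (P : Terms Sg X Y) :
    Terms Lg (d.expand X) (d.expand Y) :=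
  fun t y => d.translate (Y := d.expand X) (fun s x _ j => ⟨s, x, j⟩) (P y.1 y.2.1) t y.2.2

/-- The translation `d♯` of the families of terms of type `u → w` to families of terms of type
`φ♯(u) → φ♯(w)`. -/
def sharp (d : Polyderivor Sg Lg) {u w : List Sg.Sorts} (P : BTer Sg u w) :
    BTer Lg (u.flatMap d.sort) (w.flatMap d.sort) :=
  Tuple.ofFlat fun s k =>
    d.translate (Y := Var (u.flatMap d.sort)) (fun _ i _ j => i.flat j) (P s k)

/-- The identity polyderivor. -/
abbrev id (Sg : Signature.{u}) : Polyderivor Sg Sg where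
  sort s := [s]
  op σ := Tuple.single (Term.op σ fun _ k => Term.var (k.flat Var.zero))

/-- The composite polyderivor `e ∘ d = (ψ♯ ∘ φ, e♯ ∘ d)`. -/
abbrev comp (d : Polyderivor Sg Lg) (e : Polyderivor Lg Og) : Polyderivor Sg Og where
  sort s := (d.sort s).flatMap e.sort
  op σ := (e.sharp (d.op σ)).comp fun _ k => Term.var k.assoc

end Polyderivor

/-- A polyderivor respects the equations of two specifications if it translates the equations of the
first one to consequences of the equations of the second one. -/
def Polyderivor.Respects (𝒮 𝒯 : Spec.{u}) (d : Polyderivor 𝒮.sig 𝒯.sig) : Prop :=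
  ∀ X Y P Q, 𝒮.eqs X Y P Q → 𝒯.eqs.Cn _ _ (d.diamond P) (d.diamond Q)

/-! ### Semantics of the translations -/

section Semantics

variable {Sg Lg Og : Signature.{u}}

theorem Algebra.lift_subst (A : Algebra Sg) {X Y : Sg.Sorts → Type u}
    (f : ∀ s, Y s → A.carrier s) (g : ∀ s, X s → Term Sg Y s) {s : Sg.Sorts} (P : Term Sg X s) :
    A.lift f (P.subst g) = A.lift (fun s x => A.lift f (g s x)) P := by
  induction P with
  | var x => rfl
  | op σ a ih =>
    change A.op σ _ = A.op σ _
    congr 1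
    funext t k
    exact ih t k

/-- A sorted mapping that commutes with the operations commutes with the evaluation of terms. -/
theorem Algebra.map_lift {A B : Algebra Sg} (h : ∀ s, A.carrier s → B.carrier s)
    (hh : ∀ {w : List Sg.Sorts} {s : Sg.Sorts} (σ : Sg.Op w s) (a : Tuple A.carrier w),
      h s (A.op σ a) = B.op σ fun t k => h t (a t k))
    {X : Sg.Sorts → Type u} (f : ∀ s, X s → A.carrier s) {s : Sg.Sorts} (P : Term Sg X s) :
    h s (A.lift f P) = B.lift (fun s x => h s (f s x)) P := by
  induction P with
  | var x => rfl
  | op σ a ih =>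
    refine (hh σ _).trans ?_
    change B.op σ _ = B.op σ _
    congr 1
    funext t k
    exact ih t k

theorem Polyderivor.lift_translate (d : Polyderivor Sg Lg) (B : Algebra Lg)
    {X : Sg.Sorts → Type u} {Y : Lg.Sorts → Type u} (g : ∀ s, X s → Tuple Y (d.sort s))
    (f : ∀ s, Y s → B.carrier s) {s : Sg.Sorts} (P : Term Sg X s) {t : Lg.Sorts}
    (j : Var (d.sort s) t) :
    B.lift f (d.translate g P t j) =
      (d.pull B).lift (fun s x t j => f t (g s x t j)) P t j := by
  have := Algebra.map_lift (A := d.pull (Term.algebra Lg Y)) (B := d.pull B)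
    (fun s a t j => B.lift f (a t j))
    (fun σ a => by
      funext t j
      exact B.lift_subst f _ _) (fun s x t j => Term.var (g s x t j)) P
  exact congrFun (congrFun this t) j

/-- The satisfaction condition. -/
theorem Polyderivor.satisfies_diamond (d : Polyderivor Sg Lg) (B : Algebra Lg)
    {X Y : Sg.Sorts → Type u} (P Q : Terms Sg X Y) :
    B.Satisfies (d.diamond P) (d.diamond Q) ↔ (d.pull B).Satisfies P Q := by
  constructor
  · intro h f s y
    funext t j
    have := h (fun t x => f x.1 x.2.1 t x.2.2) t ⟨s, y, j⟩
    unfold Polyderivor.diamond at this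
    rwa [Polyderivor.lift_translate, Polyderivor.lift_translate] at this
  · intro h f t y
    unfold Polyderivor.diamond
    rw [Polyderivor.lift_translate, Polyderivor.lift_translate]
    exact congrFun (congrFun (h _ y.1 y.2.1) t) y.2.2

theorem Polyderivor.respects_iff {𝒮 𝒯 : Spec.{u}} {d : Polyderivor 𝒮.sig 𝒯.sig} :
    d.Respects 𝒮 𝒯 ↔ ∀ B : Algebra 𝒯.sig, B.Models 𝒯.eqs → (d.pull B).Models 𝒮.eqs := by
  constructor
  · intro h B hB X Y P Q hPQ
    exact (d.satisfies_diamond B P Q).1 (h X Y P Q hPQ B hB)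
  · intro h X Y P Q hPQ B hB
    exact (d.satisfies_diamond B P Q).2 (h B hB X Y P Q hPQ)

/-- A tuple of type `φ(w_0) ⋯ φ(w_{n-1})`, as a tuple of tuples. -/
def Tuple.curry {R S : Type u} {A : S → Type u} {φ : R → List S} {w : List R}
    (a : Tuple A (w.flatMap φ)) : Tuple (fun r => Tuple A (φ r)) w :=
  fun _ i t j => a t (i.flat j)

@[simp]
theorem Tuple.curry_ofFlat {R S : Type u} {A : S → Type u} {φ : R → List S} {w : List R}
    (a : Tuple (fun r => Tuple A (φ r)) w) : (Tuple.ofFlat a).curry = a := by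
  funext r i t j
  exact Tuple.ofFlat_flat a i j

theorem Tuple.curry_injective {R S : Type u} {A : S → Type u} {φ : R → List S} {w : List R}
    {a b : Tuple A (w.flatMap φ)} (h : a.curry = b.curry) : a = b := by
  funext t k
  obtain ⟨r, i, j, rfl⟩ := k.exists_flat
  exact congrFun (congrFun (congrFun (congrFun h r) i) t) j

@[simp]
theorem Tuple.ofFlat_curry {R S : Type u} {A : S → Type u} {φ : R → List S} {w : List R}
    (a : Tuple A (w.flatMap φ)) : Tuple.ofFlat a.curry = a :=
  Tuple.curry_injective (Tuple.curry_ofFlat _)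

/-- The value of a family of terms of type `u → w` at a tuple of type `u`. -/
def BTer.act (B : Algebra Lg) {u w : List Lg.Sorts} (P : BTer Lg u w) (a : Tuple B.carrier u) :
    Tuple B.carrier w :=
  fun t j => B.lift a (P t j)

theorem BTer.act_comp (B : Algebra Lg) {u v w : List Lg.Sorts} (Q : BTer Lg v w)
    (P : BTer Lg u v) (a : Tuple B.carrier u) :
    BTer.act B (Q.comp P) a = BTer.act B Q (BTer.act B P a) := by
  funext t j
  exact B.lift_subst _ _ _

theorem BTer.curry_act_sharp (d : Polyderivor Sg Lg) (B : Algebra Lg) {u w : List Sg.Sorts}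
    (P : BTer Sg u w) (a : Tuple B.carrier (u.flatMap d.sort)) :
    (BTer.act B (d.sharp P) a).curry = BTer.act (d.pull B) P a.curry := by
  funext r i t j
  unfold Polyderivor.sharp BTer.act Tuple.curry
  beta_reduce
  rw [Tuple.ofFlat_flat, Polyderivor.lift_translate]

theorem Polyderivor.curry_comp_op (d : Polyderivor Sg Lg) (e : Polyderivor Lg Og)
    (B : Algebra Og) {w : List Sg.Sorts} {s : Sg.Sorts} (σ : Sg.Op w s)
    (a : Tuple ((d.comp e).pull B).carrier w) :
    Tuple.curry (φ := e.sort) (((d.comp e).pull B).op σ a) =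
      (d.pull (e.pull B)).op σ fun r i => Tuple.curry (φ := e.sort) (a r i) := by
  have h : ((d.comp e).pull B).op σ a = BTer.act B (e.sharp (d.op σ))
      (BTer.act B (fun _ k => Term.var k.assoc) (Tuple.ofFlat a)) :=
    BTer.act_comp B _ _ _
  rw [h, BTer.curry_act_sharp]
  change BTer.act (e.pull B) (d.op σ) _ = BTer.act (e.pull B) (d.op σ) _
  congr 1
  refine Tuple.curry_injective (φ := d.sort) ?_
  rw [Tuple.curry_ofFlat]
  funext r i t j q k
  change Tuple.ofFlat a _ (Var.assoc _) = _
  rw [Var.assoc_flat]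
  exact Tuple.ofFlat_flat _ _ _

theorem Polyderivor.id_op (B : Algebra Sg) {w : List Sg.Sorts} {s : Sg.Sorts} (σ : Sg.Op w s)
    (a : Tuple ((Polyderivor.id Sg).pull B).carrier w) :
    ((Polyderivor.id Sg).pull B).op σ a s Var.zero = B.op σ fun t k => a t k t Var.zero := by
  change B.op σ (fun t k => Tuple.ofFlat a t (k.flat Var.zero)) = _
  congr 1
  funext t k
  exact Tuple.ofFlat_flat _ _ _

theorem Polyderivor.respects_id (𝒮 : Spec.{u}) :
    (Polyderivor.id 𝒮.sig).Respects 𝒮 𝒮 := by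
  rw [Polyderivor.respects_iff]
  intro B hB X Y P Q hPQ f s y
  have key := fun R : Term 𝒮.sig X s =>
    Algebra.map_lift (A := (Polyderivor.id 𝒮.sig).pull B) (B := B)
      (fun s a => a s Var.zero) (fun σ a => Polyderivor.id_op B σ a) f R
  have h := hB X Y P Q hPQ (fun s x => f s x s Var.zero) s y
  rw [← key, ← key] at h
  funext t j
  match t, j with
  | _, Var.zero => exact h

theorem Polyderivor.respects_comp {𝒮 𝒯 𝒰 : Spec.{u}} {d : Polyderivor 𝒮.sig 𝒯.sig}
    {e : Polyderivor 𝒯.sig 𝒰.sig} (hd : d.Respects 𝒮 𝒯) (he : e.Respects 𝒯 𝒰) :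
    (d.comp e).Respects 𝒮 𝒰 := by
  rw [Polyderivor.respects_iff] at *
  intro B hB X Y P Q hPQ f s y
  have key := fun R : Term 𝒮.sig X s =>
    Algebra.map_lift (A := (d.comp e).pull B) (B := d.pull (e.pull B))
      (fun _ a => Tuple.curry (φ := e.sort) a) (fun σ a => Polyderivor.curry_comp_op d e B σ a) f R
  have h := hd _ (he B hB) X Y P Q hPQ (fun s x => Tuple.curry (φ := e.sort) (f s x)) s y
  rw [← key, ← key] at h
  exact Tuple.curry_injective h

end Semantics

/-! ### The morphisms of specifications and their transformations -/

/-- A polyderivor that respects the equations of two specifications. -/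
structure SpecHom (𝒮 𝒯 : Spec.{u}) : Type (u + 1) where
  toPolyderivor : Polyderivor 𝒮.sig 𝒯.sig
  respects : toPolyderivor.Respects 𝒮 𝒯

instance : CategoryStruct Spec.{u} where
  Hom := SpecHom
  id 𝒮 := ⟨Polyderivor.id 𝒮.sig, Polyderivor.respects_id 𝒮⟩
  comp d e := ⟨d.toPolyderivor.comp e.toPolyderivor,
    Polyderivor.respects_comp d.respects e.respects⟩

section Transformations

variable {Sg : Signature.{u}} {𝒯 : Spec.{u}}

/-- A choice, for every sort `s`, of a family of terms of type `φ(s) → ψ(s)`. -/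
abbrev Components (d e : Polyderivor Sg 𝒯.sig) : Type u :=
  ∀ s : Sg.Sorts, BTer 𝒯.sig (d.sort s) (e.sort s)

/-- The extension `ξ_w = ξ_{w_0} ⋏ ⋯ ⋏ ξ_{w_{n-1}}`, of type `φ♯(w) → ψ♯(w)`, of a choice `ξ` to the
words. -/
def Components.word {d e : Polyderivor Sg 𝒯.sig} (ξ : Components d e) (w : List Sg.Sorts) :
    BTer 𝒯.sig (w.flatMap d.sort) (w.flatMap e.sort) :=
  Tuple.ofFlat fun r i => (ξ r).comp fun _ j => Term.var (i.flat j)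

/-- A choice `ξ` is a transformation from `d` to `e` if `ξ_s ∘ d(σ)` and `e(σ) ∘ ξ_w` are equal
modulo the equations of the specification, for every formal operation `σ : w → s`. -/
def IsTransformation {d e : Polyderivor Sg 𝒯.sig} (ξ : Components d e) : Prop :=
  ∀ (w : List Sg.Sorts) (s : Sg.Sorts) (σ : Sg.Op w s),
    𝒯.eqs.Cn _ _ ((ξ s).comp (d.op σ)) (Terms.comp (e.op σ) (ξ.word w))

/-- The transformations from `d` to `e`. -/
structure Transformation (d e : Polyderivor Sg 𝒯.sig) : Type u where
  app : Components d e
  natural : IsTransformation app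

/-- Two transformations are identified if their components are equal modulo the equations of the
specification. -/
instance Transformation.setoid (d e : Polyderivor Sg 𝒯.sig) : Setoid (Transformation d e) where
  r ξ χ := ∀ s, 𝒯.eqs.Cn _ _ (ξ.app s) (χ.app s)
  iseqv :=
    { refl := fun _ _ _ _ _ _ _ => rfl
      symm := fun h s B hB f t y => (h s B hB f t y).symm
      trans := fun h₁ h₂ s B hB f t y => (h₁ s B hB f t y).trans (h₂ s B hB f t y) }

/-- The 2-cells from `d` to `e`: the transformations, modulo the equations of the specification. -/
def TwoCell (d e : Polyderivor Sg 𝒯.sig) : Type u :=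
  Quotient (Transformation.setoid d e)

theorem Components.curry_act_word {d e : Polyderivor Sg 𝒯.sig} (ξ : Components d e)
    (B : Algebra 𝒯.sig) {w : List Sg.Sorts} (a : Tuple B.carrier (w.flatMap d.sort)) :
    (BTer.act B (ξ.word w) a).curry = fun r i => BTer.act B (ξ r) (a.curry r i) := by
  funext r i t j
  unfold Components.word
  refine (congrArg (B.lift a) (Tuple.ofFlat_flat _ i j)).trans ?_
  exact B.lift_subst _ _ _

/-- A choice is a transformation if and only if it induces a homomorphism in every model. -/
theorem isTransformation_iff {d e : Polyderivor Sg 𝒯.sig} {ξ : Components d e} :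
    IsTransformation ξ ↔ ∀ B : Algebra 𝒯.sig, B.Models 𝒯.eqs →
      ∀ (w : List Sg.Sorts) (s : Sg.Sorts) (σ : Sg.Op w s) (a : Tuple (d.pull B).carrier w),
        BTer.act B (ξ s) ((d.pull B).op σ a) =
          (e.pull B).op σ fun r i => BTer.act B (ξ r) (a r i) := by
  have key₁ : ∀ (B : Algebra 𝒯.sig) {w : List Sg.Sorts} {s : Sg.Sorts} (σ : Sg.Op w s)
      (a : Tuple B.carrier (w.flatMap d.sort)), BTer.act B ((ξ s).comp (d.op σ)) a =
        BTer.act B (ξ s) ((d.pull B).op σ a.curry) := by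
    intro B w s σ a
    rw [BTer.act_comp]
    congr 1
    change _ = BTer.act B (d.op σ) (Tuple.ofFlat a.curry)
    rw [Tuple.ofFlat_curry]
  have key₂ : ∀ (B : Algebra 𝒯.sig) {w : List Sg.Sorts} {s : Sg.Sorts} (σ : Sg.Op w s)
      (a : Tuple B.carrier (w.flatMap d.sort)),
        BTer.act B (Terms.comp (e.op σ) (ξ.word w)) a =
          (e.pull B).op σ fun r i => BTer.act B (ξ r) (a.curry r i) := by
    intro B w s σ a
    rw [BTer.act_comp]
    change _ = BTer.act B (e.op σ) (Tuple.ofFlat _)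
    congr 1
    rw [← ξ.curry_act_word B a, Tuple.ofFlat_curry]
  constructor
  · intro h B hB w s σ a
    have h₁ := key₁ B σ (Tuple.ofFlat a)
    have h₂ := key₂ B σ (Tuple.ofFlat a)
    rw [Tuple.curry_ofFlat] at h₁ h₂
    rw [← h₁, ← h₂]
    funext t j
    exact h w s σ B hB _ t j
  · intro h w s σ B hB f t j
    have h₁ := key₁ B σ f
    rw [h B hB w s σ, ← key₂ B σ f] at h₁
    exact congrFun (congrFun h₁ t) j

theorem Transformation.sound {d e : Polyderivor Sg 𝒯.sig} {ξ χ : Transformation d e}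
    (h : ∀ (B : Algebra 𝒯.sig), B.Models 𝒯.eqs → ∀ (s : Sg.Sorts)
      (a : Tuple B.carrier (d.sort s)), BTer.act B (ξ.app s) a = BTer.act B (χ.app s) a) :
    (Quotient.mk _ ξ : TwoCell d e) = Quotient.mk _ χ :=
  Quotient.sound fun s B hB f t j => congrFun (congrFun (h B hB s f) t) j

theorem Transformation.act_congr {d e : Polyderivor Sg 𝒯.sig} {ξ χ : Transformation d e}
    (h : ξ ≈ χ) {B : Algebra 𝒯.sig} (hB : B.Models 𝒯.eqs) (s : Sg.Sorts)
    (a : Tuple B.carrier (d.sort s)) : BTer.act B (ξ.app s) a = BTer.act B (χ.app s) a := by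
  funext t j
  exact h s B hB a t j

/-- The identity transformation: its components are the tuples of variables. -/
def Transformation.id (d : Polyderivor Sg 𝒯.sig) : Transformation d d where
  app s := Terms.id 𝒯.sig (Var (d.sort s))
  natural := isTransformation_iff.2 fun _ _ _ _ _ _ => rfl

/-- The vertical composition of transformations. -/
def Transformation.comp {d e f : Polyderivor Sg 𝒯.sig} (ξ : Transformation d e)
    (χ : Transformation e f) : Transformation d f where
  app s := (χ.app s).comp (ξ.app s)
  natural := isTransformation_iff.2 fun B hB w s σ a => by
    simp only [BTer.act_comp]
    rw [isTransformation_iff.1 ξ.natural B hB, isTransformation_iff.1 χ.natural B hB]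

end Transformations

section Whiskering

variable {Sg : Signature.{u}} {𝒮 𝒯 : Spec.{u}}

theorem Components.act_word {d e : Polyderivor Sg 𝒯.sig} (ξ : Components d e)
    (B : Algebra 𝒯.sig) {w : List Sg.Sorts} (a : Tuple B.carrier (w.flatMap d.sort)) :
    BTer.act B (ξ.word w) a = Tuple.ofFlat fun r i => BTer.act B (ξ r) (a.curry r i) := by
  rw [← ξ.curry_act_word B a, Tuple.ofFlat_curry]

theorem BTer.act_sharp {Lg : Signature.{u}} (d : Polyderivor Sg Lg) (B : Algebra Lg)
    {u w : List Sg.Sorts} (P : BTer Sg u w) (a : Tuple B.carrier (u.flatMap d.sort)) :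
    BTer.act B (d.sharp P) a = Tuple.ofFlat (φ := d.sort) (BTer.act (d.pull B) P a.curry) := by
  rw [← BTer.curry_act_sharp d B P a, Tuple.ofFlat_curry]

/-- The horizontal composite of the identity of `d` and `ξ`. -/
def Transformation.whiskerLeft (d : Polyderivor Sg 𝒮.sig) {e f : Polyderivor 𝒮.sig 𝒯.sig}
    (ξ : Transformation e f) : Transformation (d.comp e) (d.comp f) where
  app s := ξ.app.word (d.sort s)
  natural := isTransformation_iff.2 fun B hB w s σ a => by
    refine Tuple.curry_injective (φ := f.sort) ?_
    rw [Components.curry_act_word, Polyderivor.curry_comp_op, Polyderivor.curry_comp_op]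
    funext r i
    have := Algebra.map_lift (A := e.pull B) (B := f.pull B) (fun s a => BTer.act B (ξ.app s) a)
      (fun {w s} σ a => isTransformation_iff.1 ξ.natural B hB w s σ a)
      (Tuple.ofFlat fun r i => Tuple.curry (φ := e.sort) (a r i)) (d.op σ r i)
    refine this.trans ?_
    change _ = (f.pull B).lift _ (d.op σ r i)
    congr 1
    funext t k
    obtain ⟨r, i, j, rfl⟩ := k.exists_flat
    rw [Tuple.ofFlat_flat, Tuple.ofFlat_flat]
    rw [Components.curry_act_word]

/-- The horizontal composite of `ξ` and the identity of `f`. -/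
def Transformation.whiskerRight {d e : Polyderivor Sg 𝒮.sig} (ξ : Transformation d e)
    {f : Polyderivor 𝒮.sig 𝒯.sig} (hf : f.Respects 𝒮 𝒯) :
    Transformation (d.comp f) (e.comp f) where
  app s := f.sharp (ξ.app s)
  natural := isTransformation_iff.2 fun B hB w s σ a => by
    refine Tuple.curry_injective (φ := f.sort) ?_
    rw [BTer.curry_act_sharp, Polyderivor.curry_comp_op, Polyderivor.curry_comp_op,
      isTransformation_iff.1 ξ.natural _ (Polyderivor.respects_iff.1 hf B hB)]
    congr 1
    funext r i
    rw [BTer.curry_act_sharp]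

end Whiskering

section Coherence

variable {Sg Lg Og : Signature.{u}} {𝒯 : Spec.{u}}

theorem IsTransformation.of_inverse {d e : Polyderivor Sg 𝒯.sig} {ξ : Components d e}
    {ζ : Components e d} (hξ : IsTransformation ξ)
    (h₁ : ∀ (B : Algebra 𝒯.sig) (s : Sg.Sorts) (a : Tuple B.carrier (d.sort s)),
      BTer.act B (ζ s) (BTer.act B (ξ s) a) = a)
    (h₂ : ∀ (B : Algebra 𝒯.sig) (s : Sg.Sorts) (a : Tuple B.carrier (e.sort s)),
      BTer.act B (ξ s) (BTer.act B (ζ s) a) = a) : IsTransformation ζ :=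
  isTransformation_iff.2 fun B hB w s σ a => by
    have h := isTransformation_iff.1 hξ B hB w s σ fun r i => BTer.act B (ζ r) (a r i)
    have h' : (fun r i => BTer.act B (ξ r) (BTer.act B (ζ r) (a r i))) = a := by
      funext r i
      exact h₂ B r (a r i)
    rw [h'] at h
    rw [← h, h₁]

/-- The canonical identification of `h ∘ (g ∘ f)` and `(h ∘ g) ∘ f`, by a renaming of variables. -/
def Transformation.assocInv (f : Polyderivor Sg Lg) (g : Polyderivor Lg Og)
    (h : Polyderivor Og 𝒯.sig) :
    Transformation (f.comp (g.comp h)) ((f.comp g).comp h) where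
  app _ := fun _ k => Term.var k.assoc
  natural := isTransformation_iff.2 fun B hB w s σ a => by
    have key : ∀ (s : Sg.Sorts)
        (b : Tuple B.carrier ((f.sort s).flatMap fun r => (g.sort r).flatMap h.sort)),
        (BTer.act B (fun _ k => Term.var k.assoc :
          BTer 𝒯.sig _ (((f.sort s).flatMap g.sort).flatMap h.sort)) b).curry.curry =
        fun r i => Tuple.curry (φ := h.sort) (Tuple.curry (φ := (g.comp h).sort) b r i) := by
      intro s b
      funext r i t j q k
      change b _ (Var.assoc _) = _
      rw [Var.assoc_flat]
      rfl
    refine Tuple.curry_injective (φ := h.sort) (Tuple.curry_injective (φ := g.sort) ?_)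
    rw [key, Polyderivor.curry_comp_op, Polyderivor.curry_comp_op, Polyderivor.curry_comp_op]
    funext r i
    refine (Algebra.map_lift (A := (g.comp h).pull B) (B := g.pull (h.pull B))
      (fun _ a => Tuple.curry (φ := h.sort) a) (fun σ a => Polyderivor.curry_comp_op g h B σ a)
      _ (f.op σ r i)).trans ?_
    change _ = (g.pull (h.pull B)).lift _ (f.op σ r i)
    congr 1
    refine Tuple.curry_injective (φ := f.sort) ?_
    rw [Tuple.curry_ofFlat]
    funext r i
    rw [key]
    funext t j
    exact congrArg (fun c => Tuple.curry (φ := h.sort) c)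
      (Tuple.ofFlat_flat (fun r i => Tuple.curry (φ := (g.comp h).sort) (a r i)) i j)

/-- The inverse of the canonical identification of `h ∘ (g ∘ f)` and `(h ∘ g) ∘ f`. -/
def Transformation.assocHom (f : Polyderivor Sg Lg) (g : Polyderivor Lg Og)
    (h : Polyderivor Og 𝒯.sig) :
    Transformation ((f.comp g).comp h) (f.comp (g.comp h)) where
  app _ := Tuple.ofFlat (φ := (g.comp h).sort) fun _ i =>
    Tuple.ofFlat fun _ j _ k => Term.var ((i.flat j).flat k)
  natural := IsTransformation.of_inverse (Transformation.assocInv f g h).natural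
    (fun B s a => by
      funext t k
      obtain ⟨r, i, k, rfl⟩ := k.exists_flat
      obtain ⟨r', j, k, rfl⟩ := k.exists_flat
      unfold BTer.act
      rw [Tuple.ofFlat_flat, Tuple.ofFlat_flat]
      change a _ (Var.assoc _) = _
      rw [Var.assoc_flat])
    (fun B s a => by
      funext t k
      obtain ⟨r, i, k, rfl⟩ := k.exists_flat
      obtain ⟨r', i, j, rfl⟩ := i.exists_flat
      change B.lift a (Tuple.ofFlat _ _ (Var.assoc _)) = _
      rw [Var.assoc_flat, Tuple.ofFlat_flat, Tuple.ofFlat_flat]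
      rfl)

/-- The canonical identification of `f ∘ id` and `f`. -/
def Transformation.leftUnitHom (f : Polyderivor Sg 𝒯.sig) :
    Transformation ((Polyderivor.id Sg).comp f) f where
  app _ := fun _ j => Term.var (Var.flat (φ := f.sort) Var.zero j)
  natural := isTransformation_iff.2 fun B _ _ s σ a =>
    (congrFun (congrFun (Polyderivor.curry_comp_op (Polyderivor.id Sg) f B σ a) s) Var.zero).trans
      (Polyderivor.id_op (f.pull B) σ _)

/-- The inverse of the canonical identification of `f ∘ id` and `f`. -/
def Transformation.leftUnitInv (f : Polyderivor Sg 𝒯.sig) :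
    Transformation f ((Polyderivor.id Sg).comp f) where
  app s := Tuple.ofFlat (φ := f.sort)
    (Tuple.single (A := fun r => Tuple (Term 𝒯.sig (Var (f.sort s))) (f.sort r))
      fun _ j => Term.var j)
  natural := IsTransformation.of_inverse (Transformation.leftUnitHom f).natural
    (fun B s a => by
      funext t k
      obtain ⟨r, i, k, rfl⟩ := k.exists_flat
      match r, i with
      | _, Var.zero =>
        unfold BTer.act
        rw [Tuple.ofFlat_flat]
        rfl)
    (fun B s a => by
      funext t k
      change B.lift a (Tuple.ofFlat _ _ (Var.flat _ _)) = _
      rw [Tuple.ofFlat_flat]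
      rfl)

/-- The canonical identification of `id ∘ f` and `f`. -/
def Transformation.rightUnitHom (f : Polyderivor Sg 𝒯.sig) :
    Transformation (f.comp (Polyderivor.id 𝒯.sig)) f where
  app _ := fun _ j => Term.var (j.flat Var.zero)
  natural := isTransformation_iff.2 fun B _ _ s σ a => by
    funext t j
    have h := congrFun (congrFun (congrFun (congrFun
      (Polyderivor.curry_comp_op f (Polyderivor.id 𝒯.sig) B σ a) t) j) t) Var.zero
    refine h.trans ?_
    refine (Algebra.map_lift (A := (Polyderivor.id 𝒯.sig).pull B) (B := B)
      (fun s a => a s Var.zero) (fun σ a => Polyderivor.id_op B σ a) _ (f.op σ t j)).trans ?_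
    rfl

/-- The inverse of the canonical identification of `id ∘ f` and `f`. -/
def Transformation.rightUnitInv (f : Polyderivor Sg 𝒯.sig) :
    Transformation f (f.comp (Polyderivor.id 𝒯.sig)) where
  app _ := Tuple.ofFlat (φ := fun t => [t]) fun _ j => Tuple.single (Term.var j)
  natural := IsTransformation.of_inverse (Transformation.rightUnitHom f).natural
    (fun B s a => by
      funext t k
      obtain ⟨r, i, k, rfl⟩ := k.exists_flat
      match t, k with
      | _, Var.zero =>
        unfold BTer.act
        rw [Tuple.ofFlat_flat]
        rfl)
    (fun B s a => by
      funext t k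
      change B.lift a (Tuple.ofFlat _ _ (Var.flat _ _)) = _
      rw [Tuple.ofFlat_flat]
      rfl)

end Coherence

/-! ### The 2-category of specifications, polyderivors and transformations -/

instance Spec.homCategory (𝒮 𝒯 : Spec.{u}) : Category (𝒮 ⟶ 𝒯) where
  Hom d e := TwoCell (𝒯 := 𝒯) d.toPolyderivor e.toPolyderivor
  id d := Quotient.mk _ (Transformation.id d.toPolyderivor)
  comp {d e f} α β := Quotient.map₂ Transformation.comp (fun ξ ξ' h χ χ' h' s B hB a t j => by
    have : BTer.act B ((χ.app s).comp (ξ.app s)) a = BTer.act B ((χ'.app s).comp (ξ'.app s)) a := by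
      rw [BTer.act_comp, BTer.act_comp, Transformation.act_congr h hB,
        Transformation.act_congr h' hB]
    exact congrFun (congrFun this t) j) α β
  id_comp α := Quotient.inductionOn α fun ξ => Transformation.sound fun B _ s a =>
    BTer.act_comp B _ _ a
  comp_id α := Quotient.inductionOn α fun ξ => Transformation.sound fun B _ s a =>
    BTer.act_comp B _ _ a
  assoc α β γ := Quotient.inductionOn₃ α β γ fun ξ χ ζ => Transformation.sound fun B _ s a => by
    simp only [Transformation.comp, BTer.act_comp]

/-- The 2-cell given by a transformation. -/
def Transformation.toHom {𝒮 𝒯 : Spec.{u}} {d e : 𝒮 ⟶ 𝒯}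
    (ξ : Transformation (𝒯 := 𝒯) d.toPolyderivor e.toPolyderivor) : d ⟶ e :=
  Quotient.mk _ ξ

/-- An isomorphism given by two transformations that are inverse to each other in every model. -/
def Transformation.toIso {𝒮 𝒯 : Spec.{u}} {d e : 𝒮 ⟶ 𝒯}
    (ξ : Transformation (𝒯 := 𝒯) d.toPolyderivor e.toPolyderivor)
    (ζ : Transformation (𝒯 := 𝒯) e.toPolyderivor d.toPolyderivor)
    (h₁ : ∀ (B : Algebra 𝒯.sig) (s : 𝒮.sig.Sorts) (a : Tuple B.carrier (d.toPolyderivor.sort s)),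
      BTer.act B (ζ.app s) (BTer.act B (ξ.app s) a) = a)
    (h₂ : ∀ (B : Algebra 𝒯.sig) (s : 𝒮.sig.Sorts) (a : Tuple B.carrier (e.toPolyderivor.sort s)),
      BTer.act B (ξ.app s) (BTer.act B (ζ.app s) a) = a) : d ≅ e where
  hom := ξ.toHom
  inv := ζ.toHom
  hom_inv_id := Transformation.sound fun B _ s a => (BTer.act_comp B _ _ a).trans (h₁ B s a)
  inv_hom_id := Transformation.sound fun B _ s a => (BTer.act_comp B _ _ a).trans (h₂ B s a)

section Pointwise

theorem Tuple.single_eta {S : Type u} {A : S → Type u} {s : S} (a : Tuple A [s]) :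
    Tuple.single (a s Var.zero) = a := by
  funext t k
  match t, k with
  | _, Var.zero => rfl

variable {Sg Lg Og : Signature.{u}} {𝒮 𝒯 : Spec.{u}}

theorem Transformation.act_id (d : Polyderivor Sg 𝒯.sig) (B : Algebra 𝒯.sig) (s : Sg.Sorts)
    (a : Tuple B.carrier (d.sort s)) : BTer.act B ((Transformation.id d).app s) a = a :=
  rfl

theorem Transformation.act_comp {d e f : Polyderivor Sg 𝒯.sig} (ξ : Transformation d e)
    (χ : Transformation e f) (B : Algebra 𝒯.sig) (s : Sg.Sorts) (a : Tuple B.carrier (d.sort s)) :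
    BTer.act B ((ξ.comp χ).app s) a = BTer.act B (χ.app s) (BTer.act B (ξ.app s) a) :=
  BTer.act_comp B _ _ a

theorem Transformation.act_whiskerLeft (d : Polyderivor Sg 𝒮.sig) {e f : Polyderivor 𝒮.sig 𝒯.sig}
    (ξ : Transformation e f) (B : Algebra 𝒯.sig) (s : Sg.Sorts)
    (a : Tuple B.carrier ((d.sort s).flatMap e.sort)) :
    BTer.act B ((Transformation.whiskerLeft d ξ).app s) a =
      Tuple.ofFlat (φ := f.sort) fun r i => BTer.act B (ξ.app r) (a.curry r i) :=
  Components.act_word ξ.app B a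

theorem Transformation.act_whiskerRight {d e : Polyderivor Sg 𝒮.sig} (ξ : Transformation d e)
    {f : Polyderivor 𝒮.sig 𝒯.sig} (hf : f.Respects 𝒮 𝒯) (B : Algebra 𝒯.sig) (s : Sg.Sorts)
    (a : Tuple B.carrier ((d.sort s).flatMap f.sort)) :
    BTer.act B ((ξ.whiskerRight hf).app s) a =
      Tuple.ofFlat (φ := f.sort) (BTer.act (f.pull B) (ξ.app s) a.curry) :=
  BTer.act_sharp f B _ a

theorem Transformation.act_assocInv (f : Polyderivor Sg Lg) (g : Polyderivor Lg Og)
    (h : Polyderivor Og 𝒯.sig) (B : Algebra 𝒯.sig) (s : Sg.Sorts)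
    (a : Tuple B.carrier ((f.sort s).flatMap fun r => (g.sort r).flatMap h.sort)) :
    BTer.act B ((Transformation.assocInv f g h).app s) a =
      Tuple.ofFlat (φ := h.sort) (Tuple.ofFlat (φ := g.sort)
        (A := fun r => Tuple B.carrier (h.sort r)) fun r i =>
          Tuple.curry (φ := h.sort) (Tuple.curry (φ := fun r => (g.sort r).flatMap h.sort) a r i)) := by
  funext t k
  obtain ⟨r, i, k, rfl⟩ := k.exists_flat
  obtain ⟨r', i, j, rfl⟩ := i.exists_flat
  change a _ (Var.assoc _) = _
  rw [Var.assoc_flat, Tuple.ofFlat_flat, Tuple.ofFlat_flat]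
  rfl

theorem Transformation.act_assocHom (f : Polyderivor Sg Lg) (g : Polyderivor Lg Og)
    (h : Polyderivor Og 𝒯.sig) (B : Algebra 𝒯.sig) (s : Sg.Sorts)
    (a : Tuple B.carrier (((f.sort s).flatMap g.sort).flatMap h.sort)) :
    BTer.act B ((Transformation.assocHom f g h).app s) a =
      Tuple.ofFlat (φ := fun r => (g.sort r).flatMap h.sort) fun r i =>
        Tuple.ofFlat (φ := h.sort) (a.curry.curry r i) :=
  rfl

theorem Transformation.act_leftUnitHom (f : Polyderivor Sg 𝒯.sig) (B : Algebra 𝒯.sig)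
    (s : Sg.Sorts) (a : Tuple B.carrier ([s].flatMap f.sort)) :
    BTer.act B ((Transformation.leftUnitHom f).app s) a = a.curry s Var.zero :=
  rfl

theorem Transformation.act_leftUnitInv (f : Polyderivor Sg 𝒯.sig) (B : Algebra 𝒯.sig)
    (s : Sg.Sorts) (a : Tuple B.carrier (f.sort s)) :
    BTer.act B ((Transformation.leftUnitInv f).app s) a =
      Tuple.ofFlat (φ := f.sort) (Tuple.single (A := fun r => Tuple B.carrier (f.sort r)) a) := by
  funext t k
  obtain ⟨r, i, k, rfl⟩ := k.exists_flat
  match r, i with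
  | _, Var.zero =>
    unfold BTer.act Transformation.leftUnitInv
    dsimp only
    rw [Tuple.ofFlat_flat, Tuple.ofFlat_flat]
    rfl

theorem Transformation.act_rightUnitHom (f : Polyderivor Sg 𝒯.sig) (B : Algebra 𝒯.sig)
    (s : Sg.Sorts) (a : Tuple B.carrier ((f.sort s).flatMap fun t => [t])) :
    BTer.act B ((Transformation.rightUnitHom f).app s) a = fun t j => a.curry t j t Var.zero :=
  rfl

theorem Transformation.act_rightUnitInv (f : Polyderivor Sg 𝒯.sig) (B : Algebra 𝒯.sig)
    (s : Sg.Sorts) (a : Tuple B.carrier (f.sort s)) :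
    BTer.act B ((Transformation.rightUnitInv f).app s) a =
      Tuple.ofFlat (φ := fun t => [t]) fun t j => Tuple.single (a t j) := by
  funext t k
  obtain ⟨r, i, k, rfl⟩ := k.exists_flat
  match t, k with
  | _, Var.zero =>
    unfold BTer.act Transformation.rightUnitInv
    dsimp only
    rw [Tuple.ofFlat_flat, Tuple.ofFlat_flat]
    rfl

theorem BTer.curry_act_comp (f : Polyderivor Sg Lg) (g : Polyderivor Lg Og) (B : Algebra Og)
    {u w : List Sg.Sorts} (P : BTer Sg u w) (a : Tuple ((f.comp g).pull B).carrier u) :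
    (fun r i => Tuple.curry (φ := g.sort) (BTer.act ((f.comp g).pull B) P a r i)) =
      BTer.act (f.pull (g.pull B)) P fun r i => Tuple.curry (φ := g.sort) (a r i) := by
  funext r i
  exact Algebra.map_lift (A := (f.comp g).pull B) (B := f.pull (g.pull B))
    (fun _ a => Tuple.curry (φ := g.sort) a) (fun σ a => Polyderivor.curry_comp_op f g B σ a)
    _ (P r i)

theorem BTer.act_id (B : Algebra Sg) {u w : List Sg.Sorts} (P : BTer Sg u w)
    (a : Tuple ((Polyderivor.id Sg).pull B).carrier u) :
    (fun r i => BTer.act ((Polyderivor.id Sg).pull B) P a r i r Var.zero) =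
      BTer.act B P fun r i => a r i r Var.zero := by
  funext r i
  exact Algebra.map_lift (A := (Polyderivor.id Sg).pull B) (B := B)
    (fun s a => a s Var.zero) (fun σ a => Polyderivor.id_op B σ a) _ (P r i)

end Pointwise

section Coherence

variable {𝒬 ℛ 𝒮 𝒯 𝒰 : Spec.{u}}

theorem Transformation.act_whiskerLeft_comp (d : Polyderivor 𝒮.sig 𝒯.sig)
    {e f g : Polyderivor 𝒯.sig 𝒰.sig} (ξ : Transformation e f) (χ : Transformation f g)
    (B : Algebra 𝒰.sig) (s : 𝒮.sig.Sorts) (a : Tuple B.carrier ((d.sort s).flatMap e.sort)) :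
    BTer.act B ((Transformation.whiskerLeft d (ξ.comp χ)).app s) a =
      BTer.act B (((Transformation.whiskerLeft d ξ).comp
        (Transformation.whiskerLeft d χ)).app s) a := by
  simp only [Transformation.act_whiskerLeft, Transformation.act_comp, Tuple.curry_ofFlat]

theorem Transformation.act_id_whiskerRight (d : Polyderivor 𝒮.sig 𝒯.sig)
    {g : Polyderivor 𝒯.sig 𝒰.sig} (hg : g.Respects 𝒯 𝒰) (B : Algebra 𝒰.sig) (s : 𝒮.sig.Sorts)
    (a : Tuple B.carrier ((d.sort s).flatMap g.sort)) :
    BTer.act B (((Transformation.id d).whiskerRight hg).app s) a =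
      BTer.act B ((Transformation.id (d.comp g)).app s) a := by
  rw [Transformation.act_whiskerRight]
  exact Tuple.ofFlat_curry a

theorem Transformation.act_comp_whiskerRight {d e f : Polyderivor 𝒮.sig 𝒯.sig}
    (ξ : Transformation d e) (χ : Transformation e f) {g : Polyderivor 𝒯.sig 𝒰.sig}
    (hg : g.Respects 𝒯 𝒰) (B : Algebra 𝒰.sig) (s : 𝒮.sig.Sorts)
    (a : Tuple B.carrier ((d.sort s).flatMap g.sort)) :
    BTer.act B (((ξ.comp χ).whiskerRight hg).app s) a =
      BTer.act B (((ξ.whiskerRight hg).comp (χ.whiskerRight hg)).app s) a := by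
  simp only [Transformation.act_whiskerRight, Transformation.act_comp, Tuple.curry_ofFlat]

theorem Transformation.act_id_whiskerLeft {f g : Polyderivor 𝒮.sig 𝒯.sig}
    (ξ : Transformation f g) (B : Algebra 𝒯.sig) (s : 𝒮.sig.Sorts)
    (a : Tuple B.carrier ([s].flatMap f.sort)) :
    BTer.act B ((Transformation.whiskerLeft (Polyderivor.id 𝒮.sig) ξ).app s) a =
      BTer.act B (((Transformation.leftUnitHom f).comp
        (ξ.comp (Transformation.leftUnitInv g))).app s) a := by
  rw [Transformation.act_comp, Transformation.act_comp, Transformation.act_whiskerLeft,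
    Transformation.act_leftUnitHom, Transformation.act_leftUnitInv]
  congr 1
  funext r i
  match r, i with
  | _, Var.zero => rfl

theorem Transformation.act_comp_whiskerLeft (f : Polyderivor ℛ.sig 𝒮.sig)
    (g : Polyderivor 𝒮.sig 𝒯.sig) {h h' : Polyderivor 𝒯.sig 𝒰.sig} (ξ : Transformation h h')
    (B : Algebra 𝒰.sig) (s : ℛ.sig.Sorts)
    (a : Tuple B.carrier (((f.sort s).flatMap g.sort).flatMap h.sort)) :
    BTer.act B ((Transformation.whiskerLeft (f.comp g) ξ).app s) a =
      BTer.act B (((Transformation.assocHom f g h).comp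
        ((Transformation.whiskerLeft f (Transformation.whiskerLeft g ξ)).comp
          (Transformation.assocInv f g h'))).app s) a := by
  rw [Transformation.act_comp, Transformation.act_comp, Transformation.act_whiskerLeft,
    Transformation.act_assocHom, Transformation.act_whiskerLeft, Transformation.act_assocInv]
  simp only [Tuple.curry_ofFlat, Transformation.act_whiskerLeft]
  congr 1
  exact (Tuple.ofFlat_curry (A := fun r => Tuple B.carrier (h'.sort r))
    fun r i => BTer.act B (ξ.app r) (a.curry r i)).symm

theorem Transformation.act_whiskerRight_id {f g : Polyderivor 𝒮.sig 𝒯.sig}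
    (ξ : Transformation f g) (B : Algebra 𝒯.sig) (s : 𝒮.sig.Sorts)
    (a : Tuple B.carrier ((f.sort s).flatMap fun t => [t])) :
    BTer.act B ((ξ.whiskerRight (Polyderivor.respects_id 𝒯)).app s) a =
      BTer.act B (((Transformation.rightUnitHom f).comp
        (ξ.comp (Transformation.rightUnitInv g))).app s) a := by
  rw [Transformation.act_comp, Transformation.act_comp, Transformation.act_whiskerRight,
    Transformation.act_rightUnitHom, Transformation.act_rightUnitInv]
  congr 1
  funext r i
  rw [← BTer.act_id B (ξ.app s)]
  exact (Tuple.single_eta _).symm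

theorem Transformation.act_whiskerRight_comp {f f' : Polyderivor ℛ.sig 𝒮.sig}
    (ξ : Transformation f f') {g : Polyderivor 𝒮.sig 𝒯.sig} (hg : g.Respects 𝒮 𝒯)
    {h : Polyderivor 𝒯.sig 𝒰.sig} (hh : h.Respects 𝒯 𝒰) (B : Algebra 𝒰.sig) (s : ℛ.sig.Sorts)
    (a : Tuple B.carrier ((f.sort s).flatMap fun r => (g.sort r).flatMap h.sort)) :
    BTer.act B ((ξ.whiskerRight (Polyderivor.respects_comp hg hh)).app s) a =
      BTer.act B (((Transformation.assocInv f g h).comp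
        (((ξ.whiskerRight hg).whiskerRight hh).comp
          (Transformation.assocHom f' g h))).app s) a := by
  rw [Transformation.act_comp, Transformation.act_comp, Transformation.act_whiskerRight,
    Transformation.act_assocInv, Transformation.act_whiskerRight, Transformation.act_assocHom,
    Transformation.act_whiskerRight]
  simp only [Tuple.curry_ofFlat]
  rw [← BTer.curry_act_comp]
  simp only [Tuple.ofFlat_curry]

theorem Transformation.act_whisker_assoc (f : Polyderivor ℛ.sig 𝒮.sig)
    {g g' : Polyderivor 𝒮.sig 𝒯.sig} (ξ : Transformation g g')
    {h : Polyderivor 𝒯.sig 𝒰.sig} (hh : h.Respects 𝒯 𝒰) (B : Algebra 𝒰.sig) (s : ℛ.sig.Sorts)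
    (a : Tuple B.carrier (((f.sort s).flatMap g.sort).flatMap h.sort)) :
    BTer.act B (((Transformation.whiskerLeft f ξ).whiskerRight hh).app s) a =
      BTer.act B (((Transformation.assocHom f g h).comp
        ((Transformation.whiskerLeft f (ξ.whiskerRight hh)).comp
          (Transformation.assocInv f g' h))).app s) a := by
  rw [Transformation.act_comp, Transformation.act_comp, Transformation.act_whiskerRight,
    Transformation.act_assocHom, Transformation.act_whiskerLeft, Transformation.act_whiskerLeft,
    Transformation.act_assocInv]
  simp only [Tuple.curry_ofFlat, Transformation.act_whiskerRight]

theorem Transformation.act_whisker_exchange {f g : Polyderivor 𝒮.sig 𝒯.sig}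
    (ξ : Transformation f g) {h i : Polyderivor 𝒯.sig 𝒰.sig} (hh : h.Respects 𝒯 𝒰)
    (hi : i.Respects 𝒯 𝒰) (χ : Transformation h i) (B : Algebra 𝒰.sig) (hB : B.Models 𝒰.eqs)
    (s : 𝒮.sig.Sorts) (a : Tuple B.carrier ((f.sort s).flatMap h.sort)) :
    BTer.act B (((Transformation.whiskerLeft f χ).comp (ξ.whiskerRight hi)).app s) a =
      BTer.act B (((ξ.whiskerRight hh).comp (Transformation.whiskerLeft g χ)).app s) a := by
  rw [Transformation.act_comp, Transformation.act_comp, Transformation.act_whiskerRight,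
    Transformation.act_whiskerLeft, Transformation.act_whiskerRight,
    Transformation.act_whiskerLeft]
  simp only [Tuple.curry_ofFlat]
  congr 1
  funext r k
  exact (Algebra.map_lift (A := h.pull B) (B := i.pull B) (fun s a => BTer.act B (χ.app s) a)
    (fun {w s} σ a => isTransformation_iff.1 χ.natural B hB w s σ a) _ (ξ.app s r k)).symm

theorem Transformation.act_pentagon (f : Polyderivor 𝒬.sig ℛ.sig) (g : Polyderivor ℛ.sig 𝒮.sig)
    (h : Polyderivor 𝒮.sig 𝒯.sig) {i : Polyderivor 𝒯.sig 𝒰.sig} (hi : i.Respects 𝒯 𝒰)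
    (B : Algebra 𝒰.sig) (s : 𝒬.sig.Sorts)
    (a : Tuple B.carrier ((((f.sort s).flatMap g.sort).flatMap h.sort).flatMap i.sort)) :
    BTer.act B ((((Transformation.assocHom f g h).whiskerRight hi).comp
      ((Transformation.assocHom f (g.comp h) i).comp
        (Transformation.whiskerLeft f (Transformation.assocHom g h i)))).app s) a =
      BTer.act B (((Transformation.assocHom (f.comp g) h i).comp
        (Transformation.assocHom f g (h.comp i))).app s) a := by
  rw [Transformation.act_comp, Transformation.act_comp, Transformation.act_comp,
    Transformation.act_whiskerRight, Transformation.act_assocHom, Transformation.act_assocHom,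
    Transformation.act_whiskerLeft, Transformation.act_assocHom, Transformation.act_assocHom]
  simp only [Tuple.curry_ofFlat, Transformation.act_assocHom]
  rfl

theorem Transformation.act_triangle (f : Polyderivor 𝒮.sig 𝒯.sig) {g : Polyderivor 𝒯.sig 𝒰.sig}
    (hg : g.Respects 𝒯 𝒰) (B : Algebra 𝒰.sig) (s : 𝒮.sig.Sorts)
    (a : Tuple B.carrier (((f.sort s).flatMap fun t => [t]).flatMap g.sort)) :
    BTer.act B (((Transformation.assocHom f (Polyderivor.id 𝒯.sig) g).comp
      (Transformation.whiskerLeft f (Transformation.leftUnitHom g))).app s) a =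
      BTer.act B (((Transformation.rightUnitHom f).whiskerRight hg).app s) a := by
  rw [Transformation.act_comp, Transformation.act_assocHom, Transformation.act_whiskerLeft,
    Transformation.act_whiskerRight, Transformation.act_rightUnitHom]
  simp only [Tuple.curry_ofFlat, Transformation.act_leftUnitHom]

end Coherence

section Bicategory

variable {ℛ 𝒮 𝒯 𝒰 : Spec.{u}}

/-- The horizontal composite of the identity of `d` and a 2-cell. -/
def Spec.whiskerLeft (d : 𝒮 ⟶ 𝒯) {e f : 𝒯 ⟶ 𝒰} (α : e ⟶ f) : d ≫ e ⟶ d ≫ f :=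
  Quotient.map (Transformation.whiskerLeft d.toPolyderivor)
    (fun ξ χ h s B hB a t j => by
      have : BTer.act B ((Transformation.whiskerLeft d.toPolyderivor ξ).app s) a =
          BTer.act B ((Transformation.whiskerLeft d.toPolyderivor χ).app s) a := by
        rw [Transformation.act_whiskerLeft, Transformation.act_whiskerLeft]
        congr 1
        funext r i
        exact Transformation.act_congr h hB r _
      exact congrFun (congrFun this t) j) α

/-- The horizontal composite of a 2-cell and the identity of `f`. -/
def Spec.whiskerRight {d e : 𝒮 ⟶ 𝒯} (α : d ⟶ e) (f : 𝒯 ⟶ 𝒰) : d ≫ f ⟶ e ≫ f :=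
  Quotient.map (fun ξ => Transformation.whiskerRight ξ f.respects)
    (fun ξ χ h s B hB a t j => by
      have : BTer.act B ((Transformation.whiskerRight ξ f.respects).app s) a =
          BTer.act B ((Transformation.whiskerRight χ f.respects).app s) a := by
        rw [Transformation.act_whiskerRight, Transformation.act_whiskerRight,
          Transformation.act_congr h (Polyderivor.respects_iff.1 f.respects B hB)]
      exact congrFun (congrFun this t) j) α

/-- The canonical identification of `h ∘ (g ∘ f)` and `(h ∘ g) ∘ f`. -/
def Spec.associator (f : ℛ ⟶ 𝒮) (g : 𝒮 ⟶ 𝒯) (h : 𝒯 ⟶ 𝒰) : (f ≫ g) ≫ h ≅ f ≫ g ≫ h :=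
  Transformation.toIso (d := (f ≫ g) ≫ h) (e := f ≫ g ≫ h)
    (Transformation.assocHom f.toPolyderivor g.toPolyderivor h.toPolyderivor)
    (Transformation.assocInv f.toPolyderivor g.toPolyderivor h.toPolyderivor)
    (fun B s a => by
      rw [Transformation.act_assocHom, Transformation.act_assocInv]
      simp only [Tuple.curry_ofFlat, Tuple.ofFlat_curry])
    (fun B s a => by
      rw [Transformation.act_assocInv, Transformation.act_assocHom]
      simp only [Tuple.curry_ofFlat, Tuple.ofFlat_curry])

/-- The canonical identification of `f ∘ id` and `f`. -/
def Spec.leftUnitor (f : 𝒮 ⟶ 𝒯) : 𝟙 𝒮 ≫ f ≅ f :=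
  Transformation.toIso (d := 𝟙 𝒮 ≫ f) (e := f) (Transformation.leftUnitHom f.toPolyderivor)
    (Transformation.leftUnitInv f.toPolyderivor)
    (fun B s a => by
      rw [Transformation.act_leftUnitHom, Transformation.act_leftUnitInv,
        Tuple.single_eta, Tuple.ofFlat_curry])
    (fun B s a => by
      rw [Transformation.act_leftUnitInv, Transformation.act_leftUnitHom, Tuple.curry_ofFlat]
      rfl)

/-- The canonical identification of `id ∘ f` and `f`. -/
def Spec.rightUnitor (f : 𝒮 ⟶ 𝒯) : f ≫ 𝟙 𝒯 ≅ f :=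
  Transformation.toIso (d := f ≫ 𝟙 𝒯) (e := f) (Transformation.rightUnitHom f.toPolyderivor)
    (Transformation.rightUnitInv f.toPolyderivor)
    (fun B s a => by
      rw [Transformation.act_rightUnitHom, Transformation.act_rightUnitInv]
      simp only [Tuple.single_eta, Tuple.ofFlat_curry])
    (fun B s a => by
      rw [Transformation.act_rightUnitInv, Transformation.act_rightUnitHom, Tuple.curry_ofFlat]
      rfl)

end Bicategory

/-- The 2-category of specifications, of the polyderivors that respect the equations and of the
transformations modulo the equations. The composition of the polyderivors is associative and unital
up to the canonical identification of a word of words with its concatenation; these identifications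
are the associators and the unitors. -/
instance : Bicategory Spec.{u} where
  whiskerLeft := Spec.whiskerLeft
  whiskerRight := Spec.whiskerRight
  associator := Spec.associator
  leftUnitor := Spec.leftUnitor
  rightUnitor := Spec.rightUnitor
  whiskerLeft_id _ _ := Transformation.sound fun B _ s a =>
    (Transformation.act_whiskerLeft _ (Transformation.id _) B s a).trans (Tuple.ofFlat_curry a)
  whiskerLeft_comp d _ _ _ α β := by
    induction α using Quotient.inductionOn with | _ ξ
    induction β using Quotient.inductionOn with | _ χ
    exact Transformation.sound fun B _ s a =>
      Transformation.act_whiskerLeft_comp d.toPolyderivor ξ χ B s a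
  id_whiskerLeft α := by
    induction α using Quotient.inductionOn with | _ ξ
    exact Transformation.sound fun B _ s a => Transformation.act_id_whiskerLeft ξ B s a
  comp_whiskerLeft f g _ _ α := by
    induction α using Quotient.inductionOn with | _ ξ
    exact Transformation.sound fun B _ s a =>
      Transformation.act_comp_whiskerLeft f.toPolyderivor g.toPolyderivor ξ B s a
  id_whiskerRight d e := Transformation.sound fun B _ s a =>
    Transformation.act_id_whiskerRight d.toPolyderivor e.respects B s a
  comp_whiskerRight α β f := by
    induction α using Quotient.inductionOn with | _ ξ
    induction β using Quotient.inductionOn with | _ χ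
    exact Transformation.sound fun B _ s a =>
      Transformation.act_comp_whiskerRight ξ χ f.respects B s a
  whiskerRight_id α := by
    induction α using Quotient.inductionOn with | _ ξ
    exact Transformation.sound fun B _ s a => Transformation.act_whiskerRight_id ξ B s a
  whiskerRight_comp α g h := by
    induction α using Quotient.inductionOn with | _ ξ
    exact Transformation.sound fun B _ s a =>
      Transformation.act_whiskerRight_comp ξ g.respects h.respects B s a
  whisker_assoc f _ _ α h := by
    induction α using Quotient.inductionOn with | _ ξ
    exact Transformation.sound fun B _ s a =>
      Transformation.act_whisker_assoc f.toPolyderivor ξ h.respects B s a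
  whisker_exchange {_ _ _ _ _ h i} α β := by
    induction α using Quotient.inductionOn with | _ ξ
    induction β using Quotient.inductionOn with | _ χ
    exact Transformation.sound fun B hB s a =>
      Transformation.act_whisker_exchange ξ h.respects i.respects χ B hB s a
  pentagon f g h i := Transformation.sound fun B _ s a =>
    Transformation.act_pentagon _ _ _ i.respects B s a
  triangle f g := Transformation.sound fun B _ s a =>
    Transformation.act_triangle _ g.respects B s a

/-! ### The specification of Hall -/

section Hall

variable (S : Type u)

/-- The formal operations of the Hall algebras: the projections `π_i^w : λ → (w, w_i)` and the
substitution operators `ξ_{u,w,s} : ((w, s), (u, w_0), …, (u, w_{|w|-1})) → (u, s)`. -/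
inductive HallOp : List (List S × S) → List S × S → Type u
  | proj {w : List S} {s : S} (i : Var w s) : HallOp [] (w, s)
  | subst (u w : List S) (s : S) : HallOp ((w, s) :: w.map fun r => (u, r)) (u, s)

/-- The signature of the Hall algebras for `S`. -/
abbrev hallSig : Signature.{u} where
  Sorts := List S × S
  Op := HallOp S

variable {S} {X : List S × S → Type u}

/-- The term `π_i^w`. -/
def hallProj {w : List S} {s : S} (i : Var w s) : Term (hallSig S) X (w, s) :=
  Term.op (HallOp.proj i) Tuple.nil

/-- The term `ξ_{u,w,s}(P, Q_0, …, Q_{|w|-1})`. -/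
def hallSubst {u w : List S} {s : S} (P : Term (hallSig S) X (w, s))
    (Q : ∀ r, Var w r → Term (hallSig S) X (u, r)) : Term (hallSig S) X (u, s) :=
  Term.op (HallOp.subst u w s) (Tuple.cons P (Tuple.ofMap Q))

variable (S)

/-- The equations of the Hall algebras. -/
inductive HallEq : Equations (hallSig S)
  /-- `ξ_{u,w,w_i}(π_i^w, v_0, …, v_{|w|-1}) = v_i`, of type `((u, w_0), …, (u, w_{|w|-1}), (u, w_i))`. -/
  | proj (u w : List S) (s : S) (i : Var w s) :
      HallEq (Var (w.map fun r => (u, r))) (Var [(u, s)])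
        (Tuple.single (hallSubst (hallProj i) fun _ k => Term.var (k.map fun r => (u, r))))
        (Tuple.single (Term.var (i.map fun r => (u, r))))
  /-- `ξ_{u,u,s}(v_0, π_0^u, …, π_{|u|-1}^u) = v_0`, of type `((u, s), (u, s))`. -/
  | ident (u : List S) (s : S) :
      HallEq (Var [(u, s)]) (Var [(u, s)])
        (Tuple.single (hallSubst (Term.var Var.zero) fun _ k => hallProj k))
        (Tuple.single (Term.var Var.zero))
  /-- `ξ_{u,v,s}(ξ_{v,w,s}(x, y_0, …), z_0, …) = ξ_{u,w,s}(x, ξ_{u,v,w_0}(y_0, z_0, …), …)`, of type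
  `((w, s), (v, w_0), …, (v, w_{|w|-1}), (u, v_0), …, (u, v_{|v|-1}), (u, s))`. -/
  | assoc (u v w : List S) (s : S) :
      HallEq (Var ((w, s) :: ((w.map fun r => (v, r)) ++ v.map fun r => (u, r)))) (Var [(u, s)])
        (Tuple.single (hallSubst
          (hallSubst (Term.var Var.zero) fun _ k =>
            Term.var (((k.map fun r => (v, r)).left _).succ))
          fun _ k => Term.var ((Var.right _ (k.map fun r => (u, r))).succ)))
        (Tuple.single (hallSubst (Term.var Var.zero) fun _ k =>
          hallSubst (Term.var (((k.map fun r => (v, r)).left _).succ))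
            fun _ l => Term.var ((Var.right _ (l.map fun r => (u, r))).succ)))

/-- The specification `H_S` of Hall for `S`. -/
abbrev hallSpec : Spec.{u} where
  sig := hallSig S
  eqs := HallEq S

end Hall

/-! ### The specification of Bénabou -/

section Benabou

variable (S : Type u)

/-- The formal operations of the Bénabou algebras: the projections `π_i^w : λ → (w, (w_i))`, the
finite tuplings `⟨⟩_{u,w} : ((u, (w_0)), …, (u, (w_{|w|-1}))) → (u, w)` and the substitutions
`∘_{u,x,w} : ((u, x), (x, w)) → (u, w)`. -/
inductive BenabouOp : List (List S × List S) → List S × List S → Type u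
  | proj {w : List S} {s : S} (i : Var w s) : BenabouOp [] (w, [s])
  | tuple (u w : List S) : BenabouOp (w.map fun r => (u, [r])) (u, w)
  | comp (u x w : List S) : BenabouOp [(u, x), (x, w)] (u, w)

/-- The signature of the Bénabou algebras for `S`. -/
abbrev benabouSig : Signature.{u} where
  Sorts := List S × List S
  Op := BenabouOp S

variable {S} {X : List S × List S → Type u}

/-- The term `π_i^w`. -/
def benabouProj {w : List S} {s : S} (i : Var w s) : Term (benabouSig S) X (w, [s]) :=
  Term.op (BenabouOp.proj i) Tuple.nil

/-- The term `⟨P_0, …, P_{|w|-1}⟩_{u,w}`. -/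
def benabouTuple {u w : List S} (P : ∀ r, Var w r → Term (benabouSig S) X (u, [r])) :
    Term (benabouSig S) X (u, w) :=
  Term.op (BenabouOp.tuple u w) (Tuple.ofMap P)

/-- The term `Q ∘_{u,x,w} P`, which stands for `∘_{u,x,w}(P, Q)`. -/
def benabouComp {u x w : List S} (Q : Term (benabouSig S) X (x, w))
    (P : Term (benabouSig S) X (u, x)) : Term (benabouSig S) X (u, w) :=
  Term.op (BenabouOp.comp u x w) (Tuple.cons P (Tuple.single Q))

variable (S)

/-- The equations of the Bénabou algebras. -/
inductive BenabouEq : Equations (benabouSig S)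
  /-- `π_i^w ∘ ⟨v_0, …, v_{|w|-1}⟩ = v_i`, of type `((u, (w_0)), …, (u, (w_{|w|-1})), (u, (w_i)))`. -/
  | proj (u w : List S) (s : S) (i : Var w s) :
      BenabouEq (Var (w.map fun r => (u, [r]))) (Var [(u, [s])])
        (Tuple.single (benabouComp (benabouProj i)
          (benabouTuple fun _ k => Term.var (k.map fun r => (u, [r])))))
        (Tuple.single (Term.var (i.map fun r => (u, [r]))))
  /-- `v_0 ∘ ⟨π_0^u, …, π_{|u|-1}^u⟩ = v_0`, of type `((u, w), (u, w))`. -/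
  | ident (u w : List S) :
      BenabouEq (Var [(u, w)]) (Var [(u, w)])
        (Tuple.single (benabouComp (Term.var Var.zero) (benabouTuple fun _ k => benabouProj k)))
        (Tuple.single (Term.var Var.zero))
  /-- `⟨π_0^w ∘ v_0, …, π_{|w|-1}^w ∘ v_0⟩ = v_0`, of type `((u, w), (u, w))`. -/
  | eta (u w : List S) :
      BenabouEq (Var [(u, w)]) (Var [(u, w)])
        (Tuple.single (benabouTuple fun _ k => benabouComp (benabouProj k) (Term.var Var.zero)))
        (Tuple.single (Term.var Var.zero))
  /-- `⟨π_0^w⟩ = π_0^w`, of type `((w, (w_0)), (w, (w_0)))`, for a nonempty word `w`. -/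
  | single (s : S) (w : List S) :
      BenabouEq (Var [(s :: w, [s])]) (Var [(s :: w, [s])])
        (Tuple.single (benabouTuple
          (Tuple.single (A := fun r => Term (benabouSig S) _ (s :: w, [r]))
            (benabouProj Var.zero))))
        (Tuple.single (benabouProj Var.zero))
  /-- `v_0 ∘ (v_1 ∘ v_2) = (v_0 ∘ v_1) ∘ v_2`, of type `((w, y), (x, w), (u, x), (u, y))`. -/
  | assoc (u x w y : List S) :
      BenabouEq (Var [(w, y), (x, w), (u, x)]) (Var [(u, y)])
        (Tuple.single (benabouComp (Term.var Var.zero)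
          (benabouComp (Term.var Var.zero.succ) (Term.var Var.zero.succ.succ))))
        (Tuple.single (benabouComp
          (benabouComp (Term.var Var.zero) (Term.var Var.zero.succ)) (Term.var Var.zero.succ.succ)))

/-- The specification `B_S` of Bénabou for `S`. -/
abbrev benabouSpec : Spec.{u} where
  sig := benabouSig S
  eqs := BenabouEq S

end Benabou

/-! ### The polyderivors and the transformations between the two specifications -/

section Comparison

variable (S : Type u)

/-- The word `φ(u, w) = ((u, w_0), …, (u, w_{|w|-1}))`. -/
abbrev benabouToHallSort (p : List S × List S) : List (List S × S) :=
  p.2.map fun r => (p.1, r)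

/-- The operation part of the polyderivor from Bénabou to Hall: `d(π_i^w) = (π_i^w)`,
`d(⟨⟩_{u,w}) = (v_0, …, v_{|w|-1})` and `d(∘_{u,x,w})` is the family of the terms
`ξ_{u,x,w_i}(v_{|x|+i}, v_0, …, v_{|x|-1})`. -/
def benabouToHallOp : ∀ {q : List (List S × List S)} {p : List S × List S}, BenabouOp S q p →
    BTer (hallSig S) (q.flatMap (benabouToHallSort S)) (benabouToHallSort S p)
  | _, _, BenabouOp.proj i => Tuple.single (hallProj i)
  | _, _, BenabouOp.tuple u _ =>
    Tuple.ofMap fun _ k => Term.var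
      (Var.flat (φ := benabouToHallSort S) (k.map fun r => (u, [r])) Var.zero)
  | _, _, BenabouOp.comp u x w =>
    Tuple.ofMap (f := fun r => (u, r)) fun _ k => hallSubst
      (Term.var (Var.flat (φ := benabouToHallSort S) (r := (x, w)) Var.zero.succ
        (k.map fun r => (x, r))))
      fun _ l => Term.var (Var.flat (φ := benabouToHallSort S) (r := (u, x)) Var.zero
        (l.map fun r => (u, r)))

/-- The polyderivor `d` from the signature of Bénabou to the signature of Hall. -/
abbrev benabouToHall : Polyderivor (benabouSig S) (hallSig S) where
  sort := benabouToHallSort S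
  op := benabouToHallOp S

/-- The operation part of the polyderivor from Hall to Bénabou: `e(π_i^w) = (π_i^w)` and
`e(ξ_{u,w,s}) = (v_0 ∘ ⟨v_1, …, v_{|w|}⟩)`. -/
def hallToBenabouOp : ∀ {q : List (List S × S)} {p : List S × S}, HallOp S q p →
    BTer (benabouSig S) (q.flatMap fun p => [(p.1, [p.2])]) [(p.1, [p.2])]
  | _, _, HallOp.proj i => Tuple.single (benabouProj i)
  | _, _, HallOp.subst u w s =>
    Tuple.single (benabouComp
      (Term.var (Var.flat (φ := fun p => [(p.1, [p.2])]) (r := (w, s)) Var.zero Var.zero))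
      (benabouTuple fun _ k => Term.var
        (Var.flat (φ := fun p => [(p.1, [p.2])]) (k.map fun r => (u, r)).succ Var.zero)))

/-- The polyderivor `e` from the signature of Hall to the signature of Bénabou, with
`ψ(w, s) = ((w, (s)))`. -/
abbrev hallToBenabou : Polyderivor (hallSig S) (benabouSig S) where
  sort p := [(p.1, [p.2])]
  op := hallToBenabouOp S

/-- The components `(π_0^w ∘ v_0, …, π_{|w|-1}^w ∘ v_0)`, of type
`((u, w)) → ((u, (w_0)), …, (u, (w_{|w|-1})))`, of a transformation from the identity to `e ∘ d`. -/
def benabouUnit : Components (𝒯 := benabouSpec S) (Polyderivor.id (benabouSig S))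
    ((benabouToHall S).comp (hallToBenabou S)) :=
  fun p => Tuple.ofFlat (φ := (hallToBenabou S).sort)
    (Tuple.ofMap (f := fun r => (p.1, r)) fun _ k =>
      Tuple.single (benabouComp (benabouProj k) (Term.var Var.zero)))

/-- The components `⟨v_0, …, v_{|w|-1}⟩_{u,w}`, of type
`((u, (w_0)), …, (u, (w_{|w|-1}))) → ((u, w))`, of a transformation from `e ∘ d` to the identity. -/
def benabouUnitInv : Components (𝒯 := benabouSpec S)
    ((benabouToHall S).comp (hallToBenabou S)) (Polyderivor.id (benabouSig S)) :=
  fun p => Tuple.single (benabouTuple fun _ k => Term.var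
    (Var.flat (φ := (hallToBenabou S).sort) (k.map fun r => (p.1, r)) Var.zero))

/-- The components `(v_0)`, of type `((w, s)) → ((w, s))`, of a transformation from `d ∘ e` to the
identity. -/
def hallCounit : Components (𝒯 := hallSpec S)
    ((hallToBenabou S).comp (benabouToHall S)) (Polyderivor.id (hallSig S)) :=
  fun p => Tuple.single (Term.var
    (Var.flat (φ := (benabouToHall S).sort) (r := (p.1, [p.2])) Var.zero Var.zero))

/-- The components `(v_0)`, of type `((w, s)) → ((w, s))`, of a transformation from the identity to
`d ∘ e`. -/
def hallCounitInv : Components (𝒯 := hallSpec S) (Polyderivor.id (hallSig S))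
    ((hallToBenabou S).comp (benabouToHall S)) :=
  fun _ => Tuple.single (Term.var Var.zero)

end Comparison

/-- The choice `ξ` is a transformation, and `α` is the 2-cell that it gives. -/
def Represents {𝒮 𝒯 : Spec.{u}} {d e : 𝒮 ⟶ 𝒯} (α : d ⟶ e)
    (ξ : Components (𝒯 := 𝒯) d.toPolyderivor e.toPolyderivor) : Prop :=
  ∃ h : IsTransformation ξ, α = Transformation.toHom ⟨ξ, h⟩

end ManySorted

open ManySorted

namespace ManySorted

/-! ### Tuples of type `(f(w_0), …, f(w_{n-1}))` -/

section Map

variable {R S : Type u} {A : S → Type u} {f : R → S}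

/-! Everything is checked in models. By `Polyderivor.respects_iff`, a polyderivor respects the
equations exactly when it derives models of its source from models of its target; by
`isTransformation_iff`, a choice of components is a transformation exactly when it acts as a
homomorphism between derived algebras in every model.

The two kinds of models carry the same information. An element of sort `(w, s)` of a Hall algebra is
an abstract operation of arity `w` with value in `s`. A Bénabou algebra is a category on the words
in which `w` is the product of its letters: (B1) and (B3) make `p ↦ (π_i ∘ p)` and tupling mutually
inverse, and `⟨π_0, …⟩` is the identity. Polyderivors act contravariantly on algebras. Along
`benabouToHall`, a Hall algebra gives a Bénabou algebra whose arrows `u → w` are families of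
operations, composed by substitution (`isBenabou_pull`). Along `hallToBenabou`, a Bénabou algebra
gives a Hall algebra that keeps only the arrows into one-letter words, with substitution `x ∘ ⟨y_0,
…⟩` (`isHall_pull`).

Starting from a Hall algebra, the round trip only wraps elements in tuples of length one, so the
counit is a renaming of variables. Starting from a Bénabou algebra, it replaces the arrows `u → w`
by the families of arrows `u → (w_i)`, and the unit is the bijection just described. That this
bijection is a homomorphism (`isTransformation_benabouUnit`) rests on (B1), (B3), (B5) and on the
identity `π_0 ∘ p = p` for `p` with a one-letter target, which is where (B4) enters
(`Algebra.IsBenabou.proj_zero_comp`).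

In each pair of transformations only one homomorphism property is verified; the other follows
because the inverse of a bijective homomorphism is a homomorphism (`exists_iso_represents`). -/

theorem Var.exists_map {w : List R} {s : S} (k : Var (w.map f) s) :
    ∃ (r : R) (i : Var w r) (h : f r = s), k = h ▸ i.map f := by
  induction w with
  | nil => exact nomatch k
  | cons a w ih =>
    cases k with
    | zero => exact ⟨a, Var.zero, rfl, rfl⟩
    | succ k =>
      obtain ⟨r, i, rfl, rfl⟩ := ih k
      exact ⟨r, i.succ, rfl, rfl⟩

@[simp]
theorem Tuple.ofMap_map {w : List R} (a : ∀ r, Var w r → A (f r)) {r : R} (i : Var w r) :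
    Tuple.ofMap a (f r) (i.map f) = a r i := by
  induction i with
  | zero => rfl
  | succ i ih => exact ih fun r k => a r k.succ

/-- Every position of `w.map f` comes from a position of `w`, so tuples on it can be compared letter
by letter. This avoids the transports that appear because the sort of a position is an index of its
type. -/
theorem Tuple.ext_map {w : List R} {a b : Tuple A (w.map f)}
    (h : ∀ (r : R) (i : Var w r), a (f r) (i.map f) = b (f r) (i.map f)) : a = b := by
  funext s k
  obtain ⟨r, i, rfl, rfl⟩ := k.exists_map
  exact h r i

theorem Tuple.ofMap_eta {w : List R} (a : Tuple A (w.map f)) :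
    (Tuple.ofMap fun r i => a (f r) (i.map f)) = a :=
  Tuple.ext_map fun _ i => Tuple.ofMap_map _ i

theorem Tuple.map_ofMap {B : S → Type u} (g : ∀ s, A s → B s) {w : List R}
    (a : ∀ r, Var w r → A (f r)) :
    (fun s k => g s (Tuple.ofMap a s k)) = Tuple.ofMap fun r i => g (f r) (a r i) :=
  Tuple.ext_map fun r i => by rw [Tuple.ofMap_map, Tuple.ofMap_map]

theorem Tuple.cons_eta {s : S} {w : List S} (a : Tuple A (s :: w)) :
    Tuple.cons (a s Var.zero) (fun t k => a t k.succ) = a := by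
  funext t k
  cases k <;> rfl

theorem Tuple.map_cons {B : S → Type u} (g : ∀ s, A s → B s) {s : S} {w : List S} (x : A s)
    (a : Tuple A w) :
    (fun t k => g t (Tuple.cons x a t k)) = Tuple.cons (g s x) fun t k => g t (a t k) := by
  funext t k
  cases k <;> rfl

theorem Tuple.eq_nil (a : Tuple A []) : a = Tuple.nil := by
  funext t k
  exact nomatch k

theorem Tuple.single_ext {s : S} {a b : Tuple A [s]} (h : a s Var.zero = b s Var.zero) : a = b := by
  rw [← Tuple.single_eta a, h, Tuple.single_eta]

/-- The concatenation of two tuples. -/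
def Tuple.append {v w : List S} (a : Tuple A v) (b : Tuple A w) : Tuple A (v ++ w) :=
  fun s k => (k.split v).elim (a s) (b s)

@[simp]
theorem Tuple.append_left {v w : List S} (a : Tuple A v) (b : Tuple A w) {s : S} (k : Var v s) :
    Tuple.append a b s (k.left w) = a s k := by
  rw [Tuple.append, Var.split_left, Sum.elim_inl]

@[simp]
theorem Tuple.append_right {v w : List S} (a : Tuple A v) (b : Tuple A w) {s : S} (k : Var w s) :
    Tuple.append a b s (Var.right v k) = b s k := by
  rw [Tuple.append, Var.split_right, Sum.elim_inr]

end Map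

/-! ### The operations of the Hall algebras -/

section Hall

variable {S : Type u}

namespace Algebra

variable (A : Algebra (hallSig S))

/-- The projection `π_i^w` of a Hall algebra. -/
def hallProj {w : List S} {s : S} (i : Var w s) : A.carrier (w, s) :=
  A.op (HallOp.proj i) Tuple.nil

/-- The substitution `ξ_{u,w,s}(x, y_0, …, y_{|w|-1})` in a Hall algebra. -/
def hallSubst {u w : List S} {s : S} (x : A.carrier (w, s))
    (y : ∀ r, Var w r → A.carrier (u, r)) : A.carrier (u, s) :=
  A.op (HallOp.subst u w s) (Tuple.cons x (Tuple.ofMap y))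

variable {X : List S × S → Type u} (f : ∀ s, X s → A.carrier s)

@[simp]
theorem lift_hallProj {w : List S} {s : S} (i : Var w s) :
    A.lift f (ManySorted.hallProj i) = A.hallProj i :=
  congrArg (A.op (HallOp.proj i)) (Tuple.eq_nil _)

@[simp]
theorem lift_hallSubst {u w : List S} {s : S} (P : Term (hallSig S) X (w, s))
    (Q : ∀ r, Var w r → Term (hallSig S) X (u, r)) :
    A.lift f (ManySorted.hallSubst P Q) =
      A.hallSubst (A.lift f P) fun r k => A.lift f (Q r k) := by
  refine congrArg (A.op (HallOp.subst u w s)) ?_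
  refine (Tuple.map_cons (fun _ P => A.lift f P) _ _).trans (congrArg _ ?_)
  exact Tuple.map_ofMap (A := Term (hallSig S) X) (B := A.carrier) (f := fun r => (u, r))
    (fun _ P => A.lift f P) Q

theorem op_hallProj {w : List S} {s : S} (i : Var w s) (a : Tuple A.carrier []) :
    A.op (HallOp.proj i) a = A.hallProj i :=
  congrArg (A.op (HallOp.proj i)) (Tuple.eq_nil a)

/-- Naturality squares apply the operation to an arbitrary argument tuple. By eta for `Tuple.cons`
and `Tuple.ofMap`, such a tuple is always a head followed by a family, so the laws in `IsHall` apply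
to it. -/
theorem op_hallSubst {u w : List S} {s : S}
    (a : Tuple A.carrier ((w, s) :: w.map fun r => (u, r))) :
    A.op (HallOp.subst u w s) a =
      A.hallSubst (a _ Var.zero) fun _ k => a _ (k.map fun r => (u, r)).succ := by
  refine congrArg (A.op (HallOp.subst u w s)) ?_
  rw [Tuple.ofMap_eta (f := fun r => (u, r)) fun t k => a t k.succ, Tuple.cons_eta]

/-- The laws of the Hall algebras, in terms of their operations. -/
structure IsHall : Prop where
  proj_subst {u w : List S} {s : S} (i : Var w s) (y : ∀ r, Var w r → A.carrier (u, r)) :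
    A.hallSubst (A.hallProj i) y = y s i
  subst_proj {u : List S} {s : S} (x : A.carrier (u, s)) :
    A.hallSubst x (fun _ k => A.hallProj k) = x
  subst_subst {u v w : List S} {s : S} (x : A.carrier (w, s))
    (y : ∀ r, Var w r → A.carrier (v, r)) (z : ∀ r, Var v r → A.carrier (u, r)) :
    A.hallSubst (A.hallSubst x y) z = A.hallSubst x fun r k => A.hallSubst (y r k) z

variable {A}

/-- The variables of each equation are the positions of a word, so a valuation is the same thing as
a choice of arguments for the corresponding law, and evaluating both sides yields that law. -/
theorem models_hall_iff : A.Models (HallEq S) ↔ A.IsHall := by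
  constructor
  · intro h
    refine ⟨?_, ?_, ?_⟩
    · intro u w s i y
      have := h _ _ _ _ (HallEq.proj u w s i) (Tuple.ofMap y) _ Var.zero
      simpa [Tuple.single, Tuple.cons, Algebra.lift] using this
    · intro u s x
      have := h _ _ _ _ (HallEq.ident u s) (Tuple.single x) _ Var.zero
      simpa [Tuple.single, Tuple.cons, Algebra.lift] using this
    · intro u v w s x y z
      -- The variable word of (H3) is `x`, then the block of the `y_j`, then the block of the `z_j`;
      -- the valuation is put together in the same order.
      have := h _ _ _ _ (HallEq.assoc u v w s)
        (Tuple.cons x (Tuple.append (Tuple.ofMap y) (Tuple.ofMap z))) _ Var.zero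
      simpa [Tuple.single, Tuple.cons, Algebra.lift] using this
  · rintro h _ _ _ _ (⟨u, w, s, i⟩ | ⟨u, s⟩ | ⟨u, v, w, s⟩) f _ (_ | ⟨⟨⟩⟩)
    · simp [Tuple.single, Tuple.cons, Algebra.lift, h.proj_subst]
    · simp [Tuple.single, Tuple.cons, Algebra.lift, h.subst_proj]
    · simp [Tuple.single, Tuple.cons, Algebra.lift, h.subst_subst]

end Algebra

end Hall

/-! ### The operations of the Bénabou algebras -/

section Benabou

variable {S : Type u}

namespace Algebra

variable (A : Algebra (benabouSig S))

/-- The projection `π_i^w` of a Bénabou algebra. -/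
def benabouProj {w : List S} {s : S} (i : Var w s) : A.carrier (w, [s]) :=
  A.op (BenabouOp.proj i) Tuple.nil

/-- The tupling `⟨y_0, …, y_{|w|-1}⟩_{u,w}` in a Bénabou algebra. -/
def benabouTuple {u w : List S} (y : ∀ r, Var w r → A.carrier (u, [r])) : A.carrier (u, w) :=
  A.op (BenabouOp.tuple u w) (Tuple.ofMap y)

/-- The composition `q ∘ p` in a Bénabou algebra. -/
def benabouComp {u x w : List S} (q : A.carrier (x, w)) (p : A.carrier (u, x)) :
    A.carrier (u, w) :=
  A.op (BenabouOp.comp u x w) (Tuple.cons p (Tuple.single q))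

variable {X : List S × List S → Type u} (f : ∀ s, X s → A.carrier s)

@[simp]
theorem lift_benabouProj {w : List S} {s : S} (i : Var w s) :
    A.lift f (ManySorted.benabouProj i) = A.benabouProj i :=
  congrArg (A.op (BenabouOp.proj i)) (Tuple.eq_nil _)

@[simp]
theorem lift_benabouTuple {u w : List S} (P : ∀ r, Var w r → Term (benabouSig S) X (u, [r])) :
    A.lift f (ManySorted.benabouTuple P) = A.benabouTuple fun r k => A.lift f (P r k) :=
  congrArg (A.op (BenabouOp.tuple u w))
    (Tuple.map_ofMap (A := Term (benabouSig S) X) (B := A.carrier) (f := fun r => (u, [r]))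
      (fun _ P => A.lift f P) P)

@[simp]
theorem lift_benabouComp {u x w : List S} (Q : Term (benabouSig S) X (x, w))
    (P : Term (benabouSig S) X (u, x)) :
    A.lift f (ManySorted.benabouComp Q P) = A.benabouComp (A.lift f Q) (A.lift f P) := by
  refine congrArg (A.op (BenabouOp.comp u x w)) ?_
  refine (Tuple.map_cons (fun _ P => A.lift f P) _ _).trans (congrArg _ ?_)
  exact Tuple.single_ext rfl

theorem op_benabouProj {w : List S} {s : S} (i : Var w s) (a : Tuple A.carrier []) :
    A.op (BenabouOp.proj i) a = A.benabouProj i :=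
  congrArg (A.op (BenabouOp.proj i)) (Tuple.eq_nil a)

theorem op_benabouTuple {u w : List S} (a : Tuple A.carrier (w.map fun r => (u, [r]))) :
    A.op (BenabouOp.tuple u w) a = A.benabouTuple fun _ k => a _ (k.map fun r => (u, [r])) :=
  congrArg (A.op (BenabouOp.tuple u w)) (Tuple.ofMap_eta (f := fun r => (u, [r])) a).symm

theorem op_benabouComp {u x w : List S} (a : Tuple A.carrier [(u, x), (x, w)]) :
    A.op (BenabouOp.comp u x w) a =
      A.benabouComp (a _ Var.zero.succ) (a _ Var.zero) := by
  refine congrArg (A.op (BenabouOp.comp u x w)) ?_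
  rw [Tuple.single_eta fun t k => a t k.succ, Tuple.cons_eta]

/-- The laws of the Bénabou algebras, in terms of their operations. -/
structure IsBenabou : Prop where
  proj_comp_tuple {u w : List S} {s : S} (i : Var w s) (y : ∀ r, Var w r → A.carrier (u, [r])) :
    A.benabouComp (A.benabouProj i) (A.benabouTuple y) = y s i
  comp_tuple_proj {u w : List S} (p : A.carrier (u, w)) :
    A.benabouComp p (A.benabouTuple fun _ k => A.benabouProj k) = p
  tuple_proj_comp {u w : List S} (p : A.carrier (u, w)) :
    A.benabouTuple (fun _ k => A.benabouComp (A.benabouProj k) p) = p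
  tuple_single (s : S) (w : List S) :
    A.benabouTuple (Tuple.single (A := fun r => A.carrier (s :: w, [r]))
      (A.benabouProj Var.zero)) = A.benabouProj Var.zero
  comp_assoc {u x w y : List S} (p : A.carrier (w, y)) (q : A.carrier (x, w))
    (r : A.carrier (u, x)) :
    A.benabouComp p (A.benabouComp q r) = A.benabouComp (A.benabouComp p q) r

variable {A}

theorem models_benabou_iff : A.Models (BenabouEq S) ↔ A.IsBenabou := by
  constructor
  · intro h
    refine ⟨?_, ?_, ?_, ?_, ?_⟩
    · intro u w s i y
      have := h _ _ _ _ (BenabouEq.proj u w s i) (Tuple.ofMap y) _ Var.zero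
      simpa [Tuple.single, Tuple.cons, Algebra.lift] using this
    · intro u w p
      have := h _ _ _ _ (BenabouEq.ident u w) (Tuple.single p) _ Var.zero
      simpa [Tuple.single, Tuple.cons, Algebra.lift] using this
    · intro u w p
      have := h _ _ _ _ (BenabouEq.eta u w) (Tuple.single p) _ Var.zero
      simpa [Tuple.single, Tuple.cons, Algebra.lift] using this
    · intro s w
      -- The variable in the type of (B4) does not occur in its terms, but a valuation still needs a
      -- value for it: the sort is inhabited by `π_0` itself.
      have := h _ _ _ _ (BenabouEq.single s w) (Tuple.single (A.benabouProj Var.zero)) _ Var.zero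
      refine Eq.trans ?_ (this.trans (lift_benabouProj _ _ _))
      refine Eq.trans (congrArg A.benabouTuple ?_) (lift_benabouTuple _ _ _).symm
      exact Tuple.single_ext (A := fun r => A.carrier (s :: w, [r])) (lift_benabouProj _ _ _).symm
    · intro u x w y p q r
      have := h _ _ _ _ (BenabouEq.assoc u x w y) (Tuple.cons p (Tuple.cons q (Tuple.single r)))
        _ Var.zero
      simpa [Tuple.single, Tuple.cons, Algebra.lift] using this
  · rintro h _ _ _ _ (⟨u, w, s, i⟩ | ⟨u, w⟩ | ⟨u, w⟩ | ⟨s, w⟩ | ⟨u, x, w, y⟩) f _ (_ | ⟨⟨⟩⟩)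
    · simp [Tuple.single, Tuple.cons, Algebra.lift, h.proj_comp_tuple]
    · simp [Tuple.single, Tuple.cons, Algebra.lift, h.comp_tuple_proj]
    · simp [Tuple.single, Tuple.cons, Algebra.lift, h.tuple_proj_comp]
    -- The argument of this tupling is a `Tuple.single` of terms rather than a family given by a
    -- formula, so its evaluation is compared at the only position of the word.
    · refine (lift_benabouTuple _ _ _).trans (Eq.trans (congrArg A.benabouTuple ?_)
        ((h.tuple_single s w).trans (lift_benabouProj _ _ _).symm))
      exact Tuple.single_ext (A := fun r => A.carrier (s :: w, [r])) (lift_benabouProj _ _ _)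
    · simp [Tuple.single, Tuple.cons, Algebra.lift, h.comp_assoc]

end Algebra

end Benabou

/-! ### The algebras derived along the two polyderivors -/

section Derived

variable {S : Type u}

/-- (B2) gives only the right unit law. For the left one, expand `⟨π_0, …⟩ ∘ p` into its projections
by (B3), reduce them to `π_k ∘ p` by (B5) and (B1), and fold back by (B3). -/
theorem Algebra.IsBenabou.id_comp {A : Algebra (benabouSig S)} (h : A.IsBenabou) {u w : List S}
    (p : A.carrier (u, w)) :
    A.benabouComp (A.benabouTuple fun _ k => A.benabouProj k) p = p := by
  rw [← h.tuple_proj_comp (A.benabouComp _ p)]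
  simp only [h.comp_assoc, h.proj_comp_tuple, h.tuple_proj_comp]

/-- (B4) for a one-letter word says that `π_0` equals the identity tuple `⟨π_0⟩`, so the left unit
law applies. -/
theorem Algebra.IsBenabou.proj_zero_comp {A : Algebra (benabouSig S)} (h : A.IsBenabou)
    {u : List S} {s : S} (p : A.carrier (u, [s])) :
    A.benabouComp (A.benabouProj (Var.zero : Var [s] s)) p = p := by
  rw [← h.tuple_single s []]
  refine Eq.trans (congrArg (fun q => A.benabouComp (A.benabouTuple q) p) ?_) (h.id_comp p)
  exact Tuple.single_ext (A := fun r => A.carrier ([s], [r])) rfl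

/-! ### Hall algebras derived from Bénabou algebras -/

section HallToBenabou

variable (B : Algebra (benabouSig S))

theorem hallProj_pull {w : List S} {s : S} (i : Var w s) :
    ((hallToBenabou S).pull B).hallProj i = Tuple.single (B.benabouProj i) :=
  Tuple.single_ext (B.lift_benabouProj _ i)

/-- The derived operation evaluates its defining term at the concatenation of the argument tuples;
`Tuple.ofFlat_flat` recovers each block, and `Tuple.ofMap_map` selects the block of `y r k`. -/
theorem hallSubst_pull {u w : List S} {s : S}
    (x : Tuple B.carrier [(w, [s])]) (y : ∀ r, Var w r → Tuple B.carrier [(u, [r])]) :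
    ((hallToBenabou S).pull B).hallSubst (u := u) (w := w) (s := s) x y =
      Tuple.single (B.benabouComp (x _ Var.zero)
        (B.benabouTuple fun r k => y r k _ Var.zero)) := by
  refine Tuple.single_ext ((B.lift_benabouComp _ _ _).trans ?_)
  rw [Algebra.lift_benabouTuple]
  refine congrArg₂ B.benabouComp (Tuple.ofFlat_flat _ _ _) ?_
  refine congrArg B.benabouTuple ?_
  funext r k
  refine (Tuple.ofFlat_flat _ _ _).trans ?_
  exact congrArg (fun c : Tuple B.carrier [(u, [r])] => c _ Var.zero) (Tuple.ofMap_map _ k)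

/-- (H1) is (B1) and (H2) is (B2). (H3) is associativity together with `⟨y_0, …⟩ ∘ z = ⟨y_0 ∘ z,
…⟩`, the compatibility of tupling with precomposition. -/
theorem isHall_pull (hB : B.IsBenabou) : ((hallToBenabou S).pull B).IsHall where
  proj_subst i y := by
    rw [hallProj_pull, hallSubst_pull]
    exact Tuple.single_ext (hB.proj_comp_tuple i _)
  subst_proj x := by
    simp only [hallProj_pull, hallSubst_pull]
    exact Tuple.single_ext (hB.comp_tuple_proj _)
  subst_subst x y z := by
    simp only [hallSubst_pull]
    refine Tuple.single_ext ?_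
    refine (hB.comp_assoc _ _ _).symm.trans (congrArg (B.benabouComp _) ?_)
    -- The composite `⟨y⟩ ∘ ⟨z⟩` is expanded into its projections by (B3); (B5) and (B1) then turn
    -- the `k`-th one into `y_k ∘ ⟨z⟩`.
    rw [← hB.tuple_proj_comp (B.benabouComp _ _)]
    simp only [hB.comp_assoc, hB.proj_comp_tuple]
    rfl

end HallToBenabou

/-! ### Bénabou algebras derived from Hall algebras -/

section BenabouToHall

variable (B : Algebra (hallSig S))

theorem benabouProj_pull {w : List S} {s : S} (i : Var w s) :
    ((benabouToHall S).pull B).benabouProj i = Tuple.single (B.hallProj i) :=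
  Tuple.single_ext (B.lift_hallProj _ i)

/-- Tupling in the derived algebra performs no operation of `B`: it only concatenates tuples of
length one. -/
theorem benabouTuple_pull {u w : List S}
    (y : ∀ r, Var w r → Tuple B.carrier [(u, r)]) :
    ((benabouToHall S).pull B).benabouTuple (u := u) (w := w) y =
      Tuple.ofMap fun r k => y r k _ Var.zero := by
  refine Tuple.ext_map (f := fun r => (u, r)) fun r i => ?_
  refine (congrArg (B.lift _) (Tuple.ofMap_map _ i)).trans ?_
  refine (Tuple.ofFlat_flat _ _ _).trans ?_
  refine Eq.trans ?_ (Tuple.ofMap_map _ i).symm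
  exact congrArg (fun c : Tuple B.carrier [(u, r)] => c _ Var.zero) (Tuple.ofMap_map _ i)

theorem benabouComp_pull {u x w : List S} (q : Tuple B.carrier (w.map fun r => (x, r)))
    (p : Tuple B.carrier (x.map fun r => (u, r))) :
    ((benabouToHall S).pull B).benabouComp (u := u) (x := x) (w := w) q p =
      Tuple.ofMap (f := fun r => (u, r)) fun _ k => B.hallSubst (q _ (k.map fun r => (x, r)))
        fun _ l => p _ (l.map fun r => (u, r)) := by
  refine Tuple.ext_map (f := fun r => (u, r)) fun r i => ?_
  refine (congrArg (B.lift _) (Tuple.ofMap_map _ i)).trans ?_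
  refine (B.lift_hallSubst _ _ _).trans ?_
  refine Eq.trans ?_ (Tuple.ofMap_map _ i).symm
  refine congrArg₂ B.hallSubst (Tuple.ofFlat_flat _ _ _) ?_
  funext r l
  exact Tuple.ofFlat_flat _ _ _

/-- Composition is componentwise substitution, so (B1) and (B3) come from (H1), (B2) from (H2) and
(B5) from (H3), one component at a time. (B4) needs no law, since concatenating a single tuple of
length one changes nothing. -/
theorem isBenabou_pull (hB : B.IsHall) : ((benabouToHall S).pull B).IsBenabou where
  proj_comp_tuple i y := by
    rw [benabouProj_pull, benabouTuple_pull, benabouComp_pull]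
    refine Tuple.single_ext ((hB.proj_subst i _).trans ?_)
    exact Tuple.ofMap_map _ _
  comp_tuple_proj {u w} p := by
    simp only [benabouProj_pull, benabouTuple_pull, benabouComp_pull]
    refine Tuple.ext_map (f := fun r => (u, r)) fun r i => ?_
    rw [Tuple.ofMap_map]
    simp only [Tuple.ofMap_map]
    exact hB.subst_proj _
  tuple_proj_comp {u w} p := by
    simp only [benabouProj_pull, benabouTuple_pull, benabouComp_pull]
    refine Tuple.ext_map (f := fun r => (u, r)) fun r i => ?_
    rw [Tuple.ofMap_map]
    refine (hB.proj_subst i _).trans ?_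
    rfl
  tuple_single s w := by
    rw [benabouTuple_pull, benabouProj_pull]
    exact Tuple.single_ext rfl
  comp_assoc {u _ _ _} p q r := by
    simp only [benabouComp_pull]
    refine Tuple.ext_map (f := fun r => (u, r)) fun r i => ?_
    simp only [Tuple.ofMap_map]
    exact (hB.subst_subst _ _ _).symm

end BenabouToHall

theorem benabouToHall_respects :
    (benabouToHall S).Respects (benabouSpec S) (hallSpec S) :=
  Polyderivor.respects_iff.2 fun B hB =>
    Algebra.models_benabou_iff.2 (isBenabou_pull B (Algebra.models_hall_iff.1 hB))

theorem hallToBenabou_respects :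
    (hallToBenabou S).Respects (hallSpec S) (benabouSpec S) :=
  Polyderivor.respects_iff.2 fun B hB =>
    Algebra.models_hall_iff.2 (isHall_pull B (Algebra.models_benabou_iff.1 hB))

end Derived

/-! ### Transformations that are inverse to each other in the models -/

section Inverse

/-- The inverse of a bijective homomorphism is a homomorphism. The inverse laws are required in
models only, as `benabouUnit` and `benabouUnitInv` cancel by virtue of (B1) and (B3) and not in
arbitrary algebras. -/
theorem IsTransformation.of_inverse_models {Sg : Signature.{u}} {𝒯 : Spec.{u}}
    {d e : Polyderivor Sg 𝒯.sig} {ξ : Components d e} {ζ : Components e d}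
    (hξ : IsTransformation ξ)
    (h₁ : ∀ (B : Algebra 𝒯.sig), B.Models 𝒯.eqs → ∀ (s : Sg.Sorts)
      (a : Tuple B.carrier (d.sort s)), BTer.act B (ζ s) (BTer.act B (ξ s) a) = a)
    (h₂ : ∀ (B : Algebra 𝒯.sig), B.Models 𝒯.eqs → ∀ (s : Sg.Sorts)
      (a : Tuple B.carrier (e.sort s)), BTer.act B (ξ s) (BTer.act B (ζ s) a) = a) :
    IsTransformation ζ :=
  isTransformation_iff.2 fun B hB w s σ a => by
    have h := isTransformation_iff.1 hξ B hB w s σ fun r i => BTer.act B (ζ r) (a r i)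
    have h' : (fun r i => BTer.act B (ξ r) (BTer.act B (ζ r) (a r i))) = a := by
      funext r i
      exact h₂ B hB r (a r i)
    rw [h'] at h
    rw [← h, h₁ B hB]

theorem exists_iso_represents {𝒮 𝒯 : Spec.{u}} {d e : 𝒮 ⟶ 𝒯}
    {ξ : Components (𝒯 := 𝒯) d.toPolyderivor e.toPolyderivor}
    {ζ : Components (𝒯 := 𝒯) e.toPolyderivor d.toPolyderivor} (hξ : IsTransformation ξ)
    (h₁ : ∀ (B : Algebra 𝒯.sig), B.Models 𝒯.eqs → ∀ (s : 𝒮.sig.Sorts)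
      (a : Tuple B.carrier (d.toPolyderivor.sort s)),
        BTer.act B (ζ s) (BTer.act B (ξ s) a) = a)
    (h₂ : ∀ (B : Algebra 𝒯.sig), B.Models 𝒯.eqs → ∀ (s : 𝒮.sig.Sorts)
      (a : Tuple B.carrier (e.toPolyderivor.sort s)),
        BTer.act B (ξ s) (BTer.act B (ζ s) a) = a) :
    ∃ i : d ≅ e, Represents i.hom ξ ∧ Represents i.inv ζ :=
  ⟨{ hom := Transformation.toHom ⟨ξ, hξ⟩
     inv := Transformation.toHom ⟨ζ, hξ.of_inverse_models h₁ h₂⟩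
     hom_inv_id := Transformation.sound fun B hB s a =>
      (BTer.act_comp B _ _ a).trans (h₁ B hB s a)
     inv_hom_id := Transformation.sound fun B hB s a =>
      (BTer.act_comp B _ _ a).trans (h₂ B hB s a) },
    ⟨hξ, rfl⟩, ⟨hξ.of_inverse_models h₁ h₂, rfl⟩⟩

end Inverse

/-! ### The transformations between the identity of `B_S` and `e ∘ d` -/

section Unit

variable {S : Type u} (B : Algebra (benabouSig S))

/-- The type of the values is a concatenation of one-letter words. Currying regroups them as a
family indexed by the letters of the target word, the shape in which the derived algebras hold their
elements. -/
theorem curry_act_benabouUnit (p : List S × List S) (a : Tuple B.carrier [p]) :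
    Tuple.curry (φ := (hallToBenabou S).sort) (BTer.act B (benabouUnit S p) a) =
      Tuple.ofMap (A := fun r => Tuple B.carrier ((hallToBenabou S).sort r))
        (f := fun r => (p.1, r)) fun _ k =>
          Tuple.single (B.benabouComp (B.benabouProj k) (a p Var.zero)) := by
  refine Tuple.ext_map (f := fun r => (p.1, r)) fun r i => Tuple.single_ext ?_
  refine (congrArg (B.lift a) (Tuple.ofFlat_flat _ _ _)).trans ?_
  rw [Tuple.ofMap_map, Tuple.ofMap_map]
  exact (B.lift_benabouComp _ _ _).trans (congrArg₂ _ (B.lift_benabouProj _ _) rfl)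

theorem curry_act_benabouUnit_map (p : List S × List S) (a : Tuple B.carrier [p]) {r : S}
    (k : Var p.2 r) :
    Tuple.curry (φ := (hallToBenabou S).sort) (BTer.act B (benabouUnit S p) a) (p.1, r)
      (k.map fun r => (p.1, r)) _ Var.zero = B.benabouComp (B.benabouProj k) (a p Var.zero) := by
  rw [curry_act_benabouUnit, Tuple.ofMap_map]
  rfl

theorem act_benabouUnitInv (p : List S × List S)
    (b : Tuple B.carrier ((benabouToHallSort S p).flatMap (hallToBenabou S).sort)) :
    BTer.act B (benabouUnitInv S p) b =
      Tuple.single (B.benabouTuple fun r k =>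
        Tuple.curry (φ := (hallToBenabou S).sort) b (p.1, r) (k.map fun r => (p.1, r))
          _ Var.zero) :=
  Tuple.single_ext (B.lift_benabouTuple _ _)

/-- In a model this says that `p ↦ (π_i ∘ p)` is a homomorphism from the algebra to its round trip,
which is checked on the three kinds of operations. -/
theorem isTransformation_benabouUnit : IsTransformation (benabouUnit S) :=
  isTransformation_iff.2 fun B hB w s σ a => by
    have h := Algebra.models_benabou_iff.1 hB
    refine Tuple.curry_injective (φ := (hallToBenabou S).sort) ?_
    -- After currying, the algebra derived along the composite is the one derived in two stages,
    -- whose operations are computed by the `_pull` lemmas.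
    rw [Polyderivor.curry_comp_op, curry_act_benabouUnit]
    cases σ with
    | proj i =>
      refine Eq.trans ?_ (Algebra.op_benabouProj
        ((benabouToHall S).pull ((hallToBenabou S).pull B)) _ _).symm
      rw [benabouProj_pull, hallProj_pull, Polyderivor.id_op, Algebra.op_benabouProj]
      -- The target of `π_i^w` has one letter, so its only component is `π_0 ∘ π_i^w = π_i^w`.
      exact Tuple.single_ext (congrArg Tuple.single (h.proj_zero_comp _))
    | tuple u w =>
      refine Eq.trans ?_ (Algebra.op_benabouTuple
        ((benabouToHall S).pull ((hallToBenabou S).pull B)) _).symm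
      rw [Polyderivor.id_op, Algebra.op_benabouTuple, benabouTuple_pull]
      refine congrArg (Tuple.ofMap (f := fun r => (u, r))) ?_
      funext r k
      -- On one side `π_k ∘ ⟨y⟩ = y_k` by (B1). On the other side `y_k` has itself passed through
      -- the unit at a one-letter word and has become `π_0 ∘ y_k`, which is again `y_k`.
      refine Tuple.single_ext ((h.proj_comp_tuple _ _).trans ?_)
      refine (h.proj_zero_comp _).symm.trans ?_
      exact (curry_act_benabouUnit_map B (u, [r]) _ Var.zero).symm
    | comp u x w =>
      refine Eq.trans ?_ (Algebra.op_benabouComp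
        ((benabouToHall S).pull ((hallToBenabou S).pull B)) _).symm
      rw [Polyderivor.id_op, Algebra.op_benabouComp, benabouComp_pull]
      refine congrArg (Tuple.ofMap (f := fun r => (u, r))) ?_
      funext r k
      -- The identity to prove is `π_k ∘ (q ∘ p) = (π_k ∘ q) ∘ ⟨π_0 ∘ p, …⟩`: reassociate by (B5),
      -- then recognise the last tuple as `p` by (B3).
      rw [hallSubst_pull, h.comp_assoc]
      refine congrArg Tuple.single
        (congrArg₂ B.benabouComp (curry_act_benabouUnit_map B (x, w) _ k).symm ?_)
      refine (h.tuple_proj_comp _).symm.trans (congrArg B.benabouTuple ?_)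
      funext r l
      exact (curry_act_benabouUnit_map B (u, x) _ l).symm

theorem act_benabouUnitInv_act_benabouUnit (h : B.IsBenabou) (p : List S × List S)
    (a : Tuple B.carrier [p]) :
    BTer.act B (benabouUnitInv S p) (BTer.act B (benabouUnit S p) a) = a := by
  rw [act_benabouUnitInv, curry_act_benabouUnit]
  simp only [Tuple.ofMap_map]
  exact Tuple.single_ext (h.tuple_proj_comp _)

theorem act_benabouUnit_act_benabouUnitInv (h : B.IsBenabou) (p : List S × List S)
    (b : Tuple B.carrier ((benabouToHallSort S p).flatMap (hallToBenabou S).sort)) :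
    BTer.act B (benabouUnit S p) (BTer.act B (benabouUnitInv S p) b) = b := by
  refine Tuple.curry_injective (φ := (hallToBenabou S).sort) ?_
  rw [curry_act_benabouUnit, act_benabouUnitInv]
  refine Tuple.ext_map (f := fun r => (p.1, r)) fun r i => Tuple.single_ext ?_
  rw [Tuple.ofMap_map]
  exact h.proj_comp_tuple i _

end Unit

/-! ### The transformations between the identity of `H_S` and `d ∘ e` -/

section Counit

variable {S : Type u} (B : Algebra (hallSig S))

/-- The word assigned to `(w, s)` by the composite reduces to `((w, s))` itself, so the action is
the identity up to nesting of tuples of length one. -/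
theorem curry_act_hallCounitInv (p : List S × S) (a : Tuple B.carrier [p]) :
    Tuple.curry (φ := (benabouToHall S).sort) (BTer.act B (hallCounitInv S p) a) =
      Tuple.single (A := fun r => Tuple B.carrier ((benabouToHall S).sort r))
        (s := (p.1, [p.2])) a :=
  Tuple.single_ext (A := fun r => Tuple B.carrier ((benabouToHall S).sort r))
    (Tuple.single_ext rfl)

/-- Computing the derived operations of the round trip gives back the original projection and
substitution, wrapped twice in tuples of length one; no equation of the Hall algebras is needed. -/
theorem isTransformation_hallCounitInv : IsTransformation (hallCounitInv S) :=
  isTransformation_iff.2 fun B hB w s σ a => by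
    refine Tuple.curry_injective (φ := (benabouToHall S).sort) ?_
    rw [Polyderivor.curry_comp_op, curry_act_hallCounitInv]
    cases σ with
    | proj i =>
      refine Eq.trans ?_ (Algebra.op_hallProj
        ((hallToBenabou S).pull ((benabouToHall S).pull B)) _ _).symm
      rw [hallProj_pull, benabouProj_pull]
      refine congrArg Tuple.single (Tuple.single_ext ?_)
      rw [Polyderivor.id_op, Algebra.op_hallProj]
      rfl
    | subst u w s =>
      refine Eq.trans ?_ (Algebra.op_hallSubst
        ((hallToBenabou S).pull ((benabouToHall S).pull B)) _).symm
      rw [hallSubst_pull, benabouTuple_pull, benabouComp_pull]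
      refine congrArg Tuple.single (Tuple.single_ext ?_)
      refine ((Polyderivor.id_op B _ a).trans (Algebra.op_hallSubst B _)).trans ?_
      -- The composite in the derived Bénabou algebra is a family with one member, since its target
      -- word is `(s)`; only position zero has to be read.
      refine Eq.trans ?_ (Tuple.ofMap_map (f := fun r => (u, r)) _ Var.zero).symm
      refine congrArg (B.hallSubst _) ?_
      funext r k
      refine Eq.trans ?_ (Tuple.ofMap_map (f := fun r => (u, r)) _ k).symm
      rfl

theorem act_hallCounit_act_hallCounitInv (p : List S × S) (a : Tuple B.carrier [p]) :
    BTer.act B (hallCounit S p) (BTer.act B (hallCounitInv S p) a) = a :=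
  Tuple.single_ext rfl

theorem act_hallCounitInv_act_hallCounit (p : List S × S)
    (a : Tuple B.carrier ([(p.1, [p.2])].flatMap (benabouToHall S).sort)) :
    BTer.act B (hallCounitInv S p) (BTer.act B (hallCounit S p) a) = a :=
  Tuple.single_ext rfl

end Counit

end ManySorted

/-! ### The equivalence of the two specifications -/

theorem proposition75 (S : Type u) :
    Nonempty (Bicategory.Equivalence (benabouSpec S) (hallSpec S)) ∧
      ∃ (hd : (benabouToHall S).Respects (benabouSpec S) (hallSpec S))
        (he : (hallToBenabou S).Respects (hallSpec S) (benabouSpec S)),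
        let d : benabouSpec S ⟶ hallSpec S := ⟨benabouToHall S, hd⟩
        let e : hallSpec S ⟶ benabouSpec S := ⟨hallToBenabou S, he⟩
        ∃ (unit : 𝟙 (benabouSpec S) ≅ d ≫ e) (counit : e ≫ d ≅ 𝟙 (hallSpec S)),
          Represents unit.hom (benabouUnit S) ∧ Represents unit.inv (benabouUnitInv S) ∧
            Represents counit.hom (hallCounit S) ∧ Represents counit.inv (hallCounitInv S) := by
  let d : benabouSpec S ⟶ hallSpec S := ⟨benabouToHall S, benabouToHall_respects⟩
  let e : hallSpec S ⟶ benabouSpec S := ⟨hallToBenabou S, hallToBenabou_respects⟩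
  obtain ⟨η, hη⟩ := exists_iso_represents (d := 𝟙 (benabouSpec S)) (e := d ≫ e)
    (ξ := benabouUnit S) (ζ := benabouUnitInv S) isTransformation_benabouUnit
    (fun B hB => act_benabouUnitInv_act_benabouUnit B (Algebra.models_benabou_iff.1 hB))
    (fun B hB => act_benabouUnit_act_benabouUnitInv B (Algebra.models_benabou_iff.1 hB))
  -- The isomorphism is built from the identity towards the composite, the direction whose
  -- naturality was verified; the counit is its inverse.
  obtain ⟨ε, hε⟩ := exists_iso_represents (d := 𝟙 (hallSpec S)) (e := e ≫ d)
    (ξ := hallCounitInv S) (ζ := hallCounit S) isTransformation_hallCounitInv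
    (fun B _ => act_hallCounit_act_hallCounitInv B)
    (fun B _ => act_hallCounitInv_act_hallCounit B)
  -- The bicategorical equivalence also demands a triangle identity, which is obtained by adjusting
  -- the counit. The explicit unit and counit are therefore supplied separately, unadjusted, for the
  -- second claim.
  exact ⟨⟨Bicategory.Equivalence.mkOfAdjointifyCounit η ε.symm⟩, benabouToHall_respects,
    hallToBenabou_respects, η, ε.symm, hη.1, hη.2, hε.2, hε.1⟩
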